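/- Let $s\ge 2$. Let $k\ge1$, $k+1\le d\le n-1$, $s=d-k+1$, $r=n-k$, $m=\lceil n/(s+1)\rceil$, $\ell=s^{m}$, and let $F$ be a field. Index the symbols of a node by $i\in\{0,\dots,\ell-1\}$, with base-$s$ digits $i=(i_{m-1},\dots,i_0)$, and write the nodes as $C_{a(s+1)+b}\in F^{\ell}$ with group index $0\le a<m$ and in-group index $0\le b\le s$. For scalars $\lambda_{a,b,e}\in F$ ($0\le a<m$, $0\le b\le s$, $0\le e<s$) and $t\ge 0$ put $L^{(t)}_{a,b,e}=(1,\lambda_{a,b,e},\dots,\lambda_{a,b,e}^{t-1})^T$, and let $A^{(t)}_{a,b}$ be the $\ell t\times \ell$ matrix whose $(i,j)$ block is the column $L^{(t)}_{a,b,j_a}$ if $i=j$, the column $-L^{(t)}_{a,b,j_a}$ if $i_a=b\ne j_a$ and $i_u=j_u$ for all $u\neq a$, and $0$ otherwise. Call the scalars admissible if they are pairwise distinct and, for every $a$ and every $\mathcal B=\{b_1<\dots<b_t\}\subseteq\{0,\dots,s\}$, the square matrix $[A^{(t)}_{a,b_1}\ \cdots\ A^{(t)}_{a,b_t}]$ is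 invertible. Let $\mathcal C$ be the array code of all $(C_0,\dots,C_{n-1})\in (F^{\ell})^{n}$ with $\sum_{a(s+1)+b<n} A^{(r)}_{a,b}C_{a(s+1)+b}=0$. An $(N,K,\ell')$ MDS array code is a linear code in $(F^{\ell'})^N$ of dimension $K\ell'$ in which any $K$ of the $N$ nodes determine the codeword. An $(n,k,\ell)$ MSR code with repair degree $d$ is an $(n,k,\ell)$ MDS array code in which every node can be recovered from every set of $d$ other (helper) nodes by downloading from them (linear functions of their contents with) in total exactly $d\ell/(d-k+1)$ symbols, the value of the cut-set bound. (1) Let the scalars be admissible. Then the following holds. (1a) Let $h=a(s+1)+b<n$ with $b<s$. The block rows with index $i$, $i_a=b$, of the parity-check equations of $\mathcal C$ are the parity-check equations, in the vectors $(C_z(i))_{i_a=b}$, $z\ne h$, and $(C_h(i))_{i_a=c}$, $0\le c<s$, of an $(n+s-1,k+s-1,\ell/s)$ MDS array code. Its parity-check matrices are: for $z$ in group $a$ with in-group index $b'\neq b$, $I_{\ell/s}\otimes L^{(r)}_{a,b',b}$; for the $c$-th part of $C_h$, $I_{\ell/s}\otimes L^{(r)}_{a,b,c}$ if $c=b$ and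 its negative with the same indices if $c\ne b$; for $z$ in a group $a'\ne a$, the matrix of the same form as $A^{(r)}_{a',b'}$ on indices without the digit $i_a$. For every set $\mathcal H$ of $d$ nodes other than $h$, $C_h$ is recovered linearly from $\{C_j(i): i_a=b,\ j\in\mathcal H\}$; the number of symbols downloaded and the number of symbols accessed both equal $d\ell/(d-k+1)$. (1b) Let $h=a(s+1)+s<n$. For each choice of the digits $i_u$, $u\ne a$, sum the $s$ block rows of the parity-check equations of $\mathcal C$ with these digits. The resulting equations are the parity-check equations, in the vectors $(C_z(i))_{i_a=b}$ for $z=a(s+1)+b$ with $b<s$, $(\sum_{e=0}^{s-1}C_z(i+es^a))_{i_a=0}$ for $z$ outside group $a$, and $(C_h(i))_{i_a=c}$, $0\le c<s$, of an $(n+s-1,k+s-1,\ell/s)$ MDS array code. Its parity-check matrices are, respectively, $I_{\ell/s}\otimes L^{(r)}_{a,b,b}$, the matrix of the same form as $A^{(r)}_{a',b'}$ on indices without the digit $i_a$ (for $z=a'(s+1)+b'$), and $I_{\ell/s}\otimes L^{(r)}_{a,s,c}$. For every set $\mathcal H$ of $d$ nodes other than $h$, $C_h$ is recovered linearly from $\{C_j(i):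 i_a=b\}$ for the helpers $j=a(s+1)+b\in\mathcal H$ in group $a$ together with $\{\sum_{e=0}^{s-1}C_j(i+es^a): i_a=0\}$ for the helpers $j\in\mathcal H$ outside group $a$; the number of symbols downloaded equals $d\ell/(d-k+1)$. This scheme is not optimal-access: it accesses all $\ell$ symbols of each helper outside group $a$, so that it accesses more than $d\ell/(d-k+1)$ symbols as soon as there is such a helper. (1c) $\mathcal C$ is an $(n,k,\ell)$ MSR code with repair degree $d$ and sub-packetization $\ell=s^{\lceil n/(s+1)\rceil}$. (2) For $n\ge1$, admissible scalars exist in every finite field with at least $(s+1)\lceil n/(s+1)\rceil s+\sum_{t=1}^{s+1}\binom{s+1}{t}\frac{st(t-1)}{2}$ elements. (3) A field of size linear in $n$ suffices: there is a constant $K_s$, depending only on $s$, such that for all $n,k,d$ as above there is a prime power $q\le K_s n$ such that over the field with $q$ elements there are admissible scalars for which $\mathcal C$ is an $(n,k,\ell)$ MSR code with repair degree $d$. -/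

import Mathlib

/-! Array codes: a codeword is a family `c : ν → ι → F`; `ν` indexes the nodes and `ι` the
symbols stored in one node, so the code length is `card ν` and the sub-packetization is
`card ι`. -/

/-- The array code given by the parity-check equations `∑ j, H j *ᵥ c j = 0`. -/
def arrayCode {F ν ι ρ : Type*} [Field F] [Fintype ν] [Fintype ι]
    (H : ν → Matrix ρ ι F) : Submodule F (ν → ι → F) where
  carrier := {c | ∑ j, (H j).mulVec (c j) = 0}
  add_mem' := by
    intro c c' hc hc'
    simp only [Set.mem_ofPred_eq, Pi.add_apply, Matrix.mulVec_add, Finset.sum_add_distrib] at *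
    rw [hc, hc', add_zero]
  zero_mem' := by simp
  smul_mem' := by
    intro x c hc
    simp only [Set.mem_ofPred_eq, Pi.smul_apply, Matrix.mulVec_smul, ← Finset.smul_sum] at *
    rw [hc, smul_zero]

/-- `C` is a `(card ν, k, card ι)` MDS array code: its dimension is `k * card ι`, and any `k`
nodes determine the whole codeword. -/
def IsMDSArrayCode {F ν ι : Type*} [Field F] [Fintype ι]
    (C : Submodule F (ν → ι → F)) (k : ℕ) : Prop :=
  Module.finrank F C = k * Fintype.card ι ∧
    ∀ S : Finset ν, S.card = k → ∀ c ∈ C, ∀ c' ∈ C, (∀ j ∈ S, c j = c' j) → c = c'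

/-- Node `h` can be recovered from the data `D j *ᵥ c j` sent by the helper nodes `j ∈ 𝓗`. -/
def Repairs {F ν ι : Type*} [Field F] [Fintype ι] (C : Submodule F (ν → ι → F))
    (h : ν) (𝓗 : Finset ν) {β : ν → Type*} (D : ∀ j, Matrix (β j) ι F) : Prop :=
  ∃ g : (∀ j : 𝓗, β j → F) →ₗ[F] (ι → F), ∀ c ∈ C, g (fun j => (D j).mulVec (c j)) = c h

/-- The number of symbols downloaded from the helper nodes in `𝓗`. -/
def repairBandwidth {F ν ι : Type*} (𝓗 : Finset ν) {β : ν → Type*} [∀ j, Fintype (β j)]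
    (_D : ∀ j, Matrix (β j) ι F) : ℕ :=
  ∑ j ∈ 𝓗, Fintype.card (β j)

/-- The symbols of a node that have to be read in order to compute `M *ᵥ c`. -/
def accessedSymbols {F β ι : Type*} [Field F] (M : Matrix β ι F) : Set ι :=
  {i | ∃ x, M x i ≠ 0}

/-- The number of symbols read in the helper nodes in `𝓗`. -/
noncomputable def repairAccess {F ν ι : Type*} [Field F] (𝓗 : Finset ν) {β : ν → Type*}
    (D : ∀ j, Matrix (β j) ι F) : ℕ :=
  ∑ j ∈ 𝓗, (accessedSymbols (D j)).ncard

/-- The cut-set bound `d ℓ / (d - k + 1)` on the repair bandwidth. -/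
def cutSetBound (k d ℓ : ℕ) : ℚ := (d : ℚ) * ℓ / ((d : ℚ) - k + 1)

/-- `C` is a `(card ν, k, ℓ)` MSR code with repair degree `d`. -/
def IsMSRCode {F ν ι : Type*} [Field F] [Fintype ι]
    (C : Submodule F (ν → ι → F)) (k d ℓ : ℕ) : Prop :=
  Fintype.card ι = ℓ ∧ IsMDSArrayCode C k ∧
    ∀ (h : ν) (𝓗 : Finset ν), h ∉ 𝓗 → 𝓗.card = d →
      ∃ (β : ν → ℕ) (D : ∀ j, Matrix (Fin (β j)) ι F),
        Repairs C h 𝓗 D ∧ (repairBandwidth 𝓗 D : ℚ) = cutSetBound k d ℓ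

/-! The construction. Symbol indices are written through their base-`s` digits, as functions
`G → Fin s` on the set `G` of digit positions. -/

/-- The block matrix with digit position `a` and in-group index `b`: the block entry at `(i, j)`
is the column `(μ (j a) ^ p)_{p < t}` if `i = j`, minus this column if `i a = b ≠ j a` and `i`, `j`
agree at all other positions, and zero otherwise. -/
def blockMatrix {F G : Type*} [Field F] [Fintype G] [DecidableEq G] {s : ℕ} (t : ℕ)
    (a : G) (b : Fin (s + 1)) (μ : Fin s → F) : Matrix ((G → Fin s) × Fin t) (G → Fin s) F :=
  fun ip j =>
    if ip.1 = j then μ (j a) ^ (ip.2 : ℕ)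
    else if (ip.1 a).castSucc = b ∧ (j a).castSucc ≠ b ∧ ∀ u, u ≠ a → ip.1 u = j u then
      -(μ (j a) ^ (ip.2 : ℕ))
    else 0

/-- `I ⊗ L`, where `L` is the column `(x ^ p)_{p < t}`. -/
def diagMatrix {F : Type*} [Field F] (X : Type*) [DecidableEq X] (t : ℕ) (x : F) :
    Matrix (X × Fin t) X F :=
  fun ip j => if ip.1 = j then x ^ (ip.2 : ℕ) else 0

/-- The number of groups `⌈n / (s + 1)⌉`. -/
def numGroups (n s : ℕ) : ℕ := n ⌈/⌉ (s + 1)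

theorem div_lt_numGroups {n s : ℕ} (j : Fin n) : (j : ℕ) / (s + 1) < numGroups n s := by
  have hj := j.isLt
  have e : n + (s + 1) - 1 = (n - 1) + (s + 1) := by omega
  rw [numGroups, Nat.ceilDiv_eq_add_pred_div, e, Nat.add_div_right _ (Nat.succ_pos s)]
  exact Nat.lt_succ_of_le (Nat.div_le_div_right (by omega))

/-- Node `j = a (s + 1) + b` belongs to group `a`. -/
def nodeGroup {n : ℕ} (s : ℕ) (j : Fin n) : Fin (numGroups n s) := ⟨j / (s + 1), div_lt_numGroups j⟩

/-- Node `j = a (s + 1) + b` has index `b` in its group. -/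
def nodePos {n : ℕ} (s : ℕ) (j : Fin n) : Fin (s + 1) :=
  ⟨j % (s + 1), Nat.mod_lt _ (Nat.succ_pos s)⟩

/-- Symbol indices `0 ≤ i < s ^ ⌈n / (s + 1)⌉`, as digit vectors. -/
abbrev SymbolIndex (n s : ℕ) : Type := Fin (numGroups n s) → Fin s

/-- The scalars of the construction, `lam (a, b, j)` being `λ_{a s (s + 1) + b s + j}`. -/
abbrev Scalars (F : Type*) (n s : ℕ) : Type _ := Fin (numGroups n s) × Fin (s + 1) × Fin s → F

/-- The square matrix `A_{a, B} = [A_{a, b₁} ⋯ A_{a, b_t}]` with `t = |B|` rows per block. -/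
def localMatrix {F : Type*} [Field F] {n s : ℕ} (lam : Scalars F n s)
    (a : Fin (numGroups n s)) (B : Finset (Fin (s + 1))) :
    Matrix (SymbolIndex n s × Fin B.card) (SymbolIndex n s × Fin B.card) F :=
  fun ip jq =>
    blockMatrix B.card a (B.orderEmbOfFin rfl jq.2)
      (fun e => lam (a, B.orderEmbOfFin rfl jq.2, e)) ip jq.1

/-- The scalars are distinct and satisfy the local constraints. -/
def Admissible {F : Type*} [Field F] {n s : ℕ} (lam : Scalars F n s) : Prop :=
  Function.Injective lam ∧ ∀ a B, (localMatrix lam a B).det ≠ 0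

/-- The parity-check matrix of node `j`. -/
def parityCheck {F : Type*} [Field F] {n s : ℕ} (lam : Scalars F n s) (r : ℕ) (j : Fin n) :
    Matrix (SymbolIndex n s × Fin r) (SymbolIndex n s) F :=
  blockMatrix r (nodeGroup s j) (nodePos s j) (fun e => lam (nodeGroup s j, nodePos s j, e))

/-- The code of the second construction with length `n` and redundancy `r`. -/
def secondCode {F : Type*} [Field F] {n s : ℕ} (lam : Scalars F n s) (r : ℕ) :
    Submodule F (Fin n → SymbolIndex n s → F) :=
  arrayCode (parityCheck lam r)

/-- Symbol indices with the digit at position `a` left out. -/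
abbrev RestIndex {n s : ℕ} (a : Fin (numGroups n s)) : Type :=
  {u : Fin (numGroups n s) // u ≠ a} → Fin s

/-- The symbol index with digit `e` at position `a` and the digits `x` elsewhere. -/
def insertDigit {n s : ℕ} (a : Fin (numGroups n s)) (e : Fin s) (x : RestIndex a) :
    SymbolIndex n s :=
  (Equiv.funSplitAt a (Fin s)).symm (e, x)

/-- Repair of a node in group `a` with in-group index `b < s`: each helper sends its symbols
whose index has digit `b` at position `a`. -/
def downloadFirst {n s : ℕ} (F : Type*) [Field F] (a : Fin (numGroups n s)) (b : Fin s)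
    (_j : Fin n) : Matrix (RestIndex a) (SymbolIndex n s) F :=
  fun x i => if i = insertDigit a b x then 1 else 0

/-- Repair of the last node of group `a`: a helper in group `a` with in-group index `b` sends its
symbols whose index has digit `b` at position `a`; a helper outside group `a` sends, for each
choice `x` of the other digits, the sum of its `s` symbols with these digits. -/
def downloadLast {n s : ℕ} (F : Type*) [Field F] (a : Fin (numGroups n s))
    (j : Fin n) : Matrix (RestIndex a) (SymbolIndex n s) F :=
  fun x i =>
    if ∃ e : Fin s, (nodeGroup s j = a → e.castSucc = nodePos s j) ∧ i = insertDigit a e x then 1 else 0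

/-- The `n + s - 1` nodes of the reduced code: the nodes other than `h`, and `s` parts of `h`. -/
abbrev ReducedNode {n : ℕ} (s : ℕ) (h : Fin n) : Type := {j : Fin n // j ≠ h} ⊕ Fin s

/-- The reduced word: the node `z ≠ h` is replaced by the data it sends, and the node `h` is split
into `s` parts according to the digit at the position of its group. -/
def reducedWord {F : Type*} [Field F] {n s : ℕ} (h : Fin n)
    (D : Fin n → Matrix (RestIndex (nodeGroup s h)) (SymbolIndex n s) F)
    (c : Fin n → SymbolIndex n s → F) : ReducedNode s h → RestIndex (nodeGroup s h) → F
  | Sum.inl z => (D z).mulVec (c z)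
  | Sum.inr e => fun x => c h (insertDigit (nodeGroup s h) e x)

/-- Reduced parity-check matrices for the repair of a node `h` with in-group index `b < s`. -/
def reducedCheckFirst {F : Type*} [Field F] {n s : ℕ} (lam : Scalars F n s) (r : ℕ) (h : Fin n)
    (b : Fin s) : ReducedNode s h →
      Matrix (RestIndex (nodeGroup s h) × Fin r) (RestIndex (nodeGroup s h)) F
  | Sum.inl z =>
      if hz : nodeGroup s z.1 ≠ nodeGroup s h then
        blockMatrix r ⟨nodeGroup s z.1, hz⟩ (nodePos s z.1) (fun e => lam (nodeGroup s z.1, nodePos s z.1, e))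
      else diagMatrix _ r (lam (nodeGroup s h, nodePos s z.1, b))
  | Sum.inr e =>
      if e = b then diagMatrix _ r (lam (nodeGroup s h, b.castSucc, e))
      else -diagMatrix _ r (lam (nodeGroup s h, b.castSucc, e))

/-- Reduced parity-check matrices for the repair of the last node `h` of a group. (The value `0`
is never taken then: a node `z ≠ h` of the same group has in-group index `< s`.) -/
def reducedCheckLast {F : Type*} [Field F] {n s : ℕ} (lam : Scalars F n s) (r : ℕ) (h : Fin n) :
    ReducedNode s h → Matrix (RestIndex (nodeGroup s h) × Fin r) (RestIndex (nodeGroup s h)) F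
  | Sum.inl z =>
      if hz : nodeGroup s z.1 ≠ nodeGroup s h then
        blockMatrix r ⟨nodeGroup s z.1, hz⟩ (nodePos s z.1) (fun e => lam (nodeGroup s z.1, nodePos s z.1, e))
      else if hp : (nodePos s z.1 : ℕ) < s then
        diagMatrix _ r (lam (nodeGroup s h, nodePos s z.1, ⟨nodePos s z.1, hp⟩))
      else 0
  | Sum.inr e => diagMatrix _ r (lam (nodeGroup s h, Fin.last s, e))

/-- The field size `(s + 1) ⌈n / (s + 1)⌉ s + ∑_{t = 1}^{s + 1} (s + 1 choose t) s t (t - 1) / 2`,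
which is `n s + ∑ …` when `s + 1` divides `n`. -/
def fieldSizeBound (n s : ℕ) : ℕ :=
  (s + 1) * numGroups n s * s +
    ∑ t ∈ Finset.Icc 1 (s + 1), (s + 1).choose t * (s * (t * (t - 1) / 2))

/-!
A node with index `b` in group `a` contributes blocks `M Λ ^ p` to the parity-check equations,
`p < r`, where `Λ` is diagonal and both `M` and `Λ` act on the digit at position `a` only. Nodes of
different groups therefore have commuting matrices, and since the scalars are distinct, their
matrices `Λ` agree on no nonzero vector.

Suppose that a word on a set `B` of nodes is determined by its first `|B|` power sums `∑ M Λ ^ p c`,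
that the same holds for `T`, and that the nodes of `B` and `T` are related in this way. Given a word
on `B ∪ T` with vanishing power sums, one writes the first `|B|` power sums of each node `w` of `T`
as those of a word `d w` on `B`, and compares power sums of index `|B|` to get a word on `T` whose
first `|T|` power sums vanish. Hence the power sums of `d w` and of `w` agree for the index `|B|` as
well, which forces the symbols of `w` to be zero. So it is enough to consider one group, where the
condition is the local constraint; this gives the MDS property.

The equations used to repair a node involve the same kinds of nodes on the remaining digits,
together with nodes `I ⊗ L` whose scalars are distinct from each other and from those of the other
groups. The same argument shows that they define an MDS code, in which the data sent by `d` helpers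
determine the `s` parts of the missing node.

Admissible scalars exist because the product of the Vandermonde determinant in all scalars and of
the determinants of the local constraints is a nonzero polynomial of degree less than the field size
in each variable. A local determinant does not vanish identically: for scalars that depend only on
the index in the group it is nonzero by a Vandermonde argument.
-/

section JointInjectivity

variable {R F ν ι ρ : Type*} [CommRing R] [Field F] [Fintype ι]

/-- The blocks `H z`, `z ∈ S`, are jointly injective: the block row `[H z]_{z ∈ S}` has trivial
kernel. This is the form in which invertibility of the square matrices of the construction, and the
MDS property, are used. -/
def JointlyInjectiveOn (H : ν → Matrix ρ ι R) (S : Finset ν) : Prop :=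
  ∀ c : ν → ι → R, ∑ z ∈ S, (H z).mulVec (c z) = 0 → ∀ z ∈ S, c z = 0

theorem JointlyInjectiveOn.smul [NoZeroDivisors R] {H : ν → Matrix ρ ι R} {S : Finset ν}
    (h : JointlyInjectiveOn H S) {ε : ν → R} (hε : ∀ z ∈ S, ε z ≠ 0) :
    JointlyInjectiveOn (fun z => ε z • H z) S := by
  intro c hc z hz
  simp only [Matrix.smul_mulVec, ← Matrix.mulVec_smul] at hc
  exact (smul_eq_zero.1 (h (fun z => ε z • c z) hc z hz)).resolve_left (hε z hz)

theorem JointlyInjectiveOn.exists_sum_mulVec_eq [Fintype ρ] {H : ν → Matrix ρ ι F} {S : Finset ν}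
    (h : JointlyInjectiveOn H S) (hcard : S.card * Fintype.card ι = Fintype.card ρ) (w : ρ → F) :
    ∃ c : ν → ι → F, (∀ z ∉ S, c z = 0) ∧ ∑ z ∈ S, (H z).mulVec (c z) = w := by
  classical
  let extend (c : S → ι → F) (z : ν) : ι → F := if hz : z ∈ S then c ⟨z, hz⟩ else 0
  have extend_coe (c : S → ι → F) (z : S) : extend c z = c z := dif_pos z.2
  let φ : (S → ι → F) →ₗ[F] (ρ → F) := ∑ z : S, (H z).mulVecLin ∘ₗ LinearMap.proj z
  have φ_apply (c : S → ι → F) : φ c = ∑ z ∈ S, (H z).mulVec (extend c z) := by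
    rw [← Finset.sum_coe_sort S]
    simp only [φ, extend_coe, LinearMap.sum_apply, LinearMap.comp_apply, LinearMap.proj_apply,
      Matrix.mulVecLin_apply]
  have injective_φ : Function.Injective φ := by
    refine (injective_iff_map_eq_zero φ).2 fun c hc => funext fun z => ?_
    rw [← extend_coe c z]
    exact h (extend c) ((φ_apply c).symm.trans hc) z z.2
  have finrank_eq : Module.finrank F (S → ι → F) = Module.finrank F (ρ → F) := by
    simp [Module.finrank_pi_fintype, hcard]
  obtain ⟨c, hc⟩ :=
    (LinearMap.injective_iff_surjective_of_finrank_eq_finrank finrank_eq).1 injective_φ w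
  exact ⟨extend c, fun z hz => dif_neg hz, (φ_apply c).symm.trans hc⟩

variable [Fintype ν] [Fintype ρ] {H : ν → Matrix ρ ι F} {k r : ℕ}

theorem finrank_arrayCode (hkr : k + r = Fintype.card ν)
    (hρ : Fintype.card ρ = r * Fintype.card ι)
    (h : ∃ S : Finset ν, S.card = r ∧ JointlyInjectiveOn H S) :
    Module.finrank F (arrayCode H) = k * Fintype.card ι := by
  obtain ⟨S, hS, hinj⟩ := h
  let φ : (ν → ι → F) →ₗ[F] (ρ → F) := ∑ z, (H z).mulVecLin ∘ₗ LinearMap.proj z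
  have φ_apply (c : ν → ι → F) : φ c = ∑ z, (H z).mulVec (c z) := by
    simp only [φ, LinearMap.sum_apply, LinearMap.comp_apply, LinearMap.proj_apply,
      Matrix.mulVecLin_apply]
  have ker_φ : LinearMap.ker φ = arrayCode H := Submodule.ext fun c => by
    rw [LinearMap.mem_ker, φ_apply]; rfl
  have range_φ : LinearMap.range φ = ⊤ := LinearMap.range_eq_top.2 fun w => by
    obtain ⟨c, hc, hcw⟩ := hinj.exists_sum_mulVec_eq (by rw [hS, hρ]) w
    refine ⟨c, (φ_apply c).trans (Eq.trans ?_ hcw)⟩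
    exact (Finset.sum_subset S.subset_univ fun z _ hz => by rw [hc z hz, Matrix.mulVec_zero]).symm
  have rank_nullity := LinearMap.finrank_range_add_finrank_ker φ
  rw [range_φ, ker_φ, finrank_top, Module.finrank_fintype_fun_eq_card, hρ,
    Module.finrank_pi_fintype] at rank_nullity
  simp only [Module.finrank_fintype_fun_eq_card, Finset.sum_const, Finset.card_univ, smul_eq_mul,
    ← hkr, add_mul] at rank_nullity
  omega

theorem isMDSArrayCode_of_jointlyInjectiveOn (hkr : k + r = Fintype.card ν)
    (hρ : Fintype.card ρ = r * Fintype.card ι)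
    (h : ∀ S : Finset ν, S.card = r → JointlyInjectiveOn H S) :
    IsMDSArrayCode (arrayCode H) k := by
  classical
  refine ⟨?_, fun S hS c hc c' hc' hcc' => ?_⟩
  · obtain ⟨S, -, hS⟩ := Finset.exists_subset_card_eq (s := (Finset.univ : Finset ν)) (n := r)
      (by rw [Finset.card_univ]; omega)
    exact finrank_arrayCode hkr hρ ⟨S, hS, h S hS⟩
  · have hcompl : ∑ z ∈ Sᶜ, (H z).mulVec ((c - c') z) = 0 := by
      rw [← (arrayCode H).sub_mem hc hc']
      refine Finset.sum_subset (Finset.subset_univ _) fun z _ hz => ?_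
      rw [Pi.sub_apply, hcc' z (by simpa using hz), sub_self, Matrix.mulVec_zero]
    funext z
    by_cases hz : z ∈ S
    · exact hcc' z hz
    · exact sub_eq_zero.1
        (h Sᶜ (by rw [Finset.card_compl]; omega) (c - c') hcompl z (Finset.mem_compl.2 hz))

end JointInjectivity

section BlockColumns

variable {α R ρ ι : Type*} [LinearOrder α]

/-- The matrix `[H b₁ ⋯ H b_t]` whose blocks of columns are the `H b`, `b ∈ B = {b₁ < ⋯ < b_t}`. -/
def blockColumns (H : α → Matrix ρ ι R) (B : Finset α) : Matrix ρ (ι × Fin B.card) R :=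
  fun i jq => H (B.orderEmbOfFin rfl jq.2) i jq.1

variable [CommRing R] [Fintype ι]

theorem blockColumns_mulVec (H : α → Matrix ρ ι R) (B : Finset α) (c : α → ι → R) :
    (blockColumns H B).mulVec (fun jq => c (B.orderEmbOfFin rfl jq.2) jq.1) =
      ∑ b ∈ B, (H b).mulVec (c b) := by
  funext i
  conv_rhs => rw [← Finset.map_orderEmbOfFin_univ B rfl, Finset.sum_map]
  simp only [Matrix.mulVec, dotProduct, blockColumns, Fintype.sum_prod_type_right,
    Finset.sum_apply, RelEmbedding.coe_toEmbedding]

theorem det_blockColumns_ne_zero_iff [IsDomain R] [DecidableEq ι] {B : Finset α}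
    {H : α → Matrix (ι × Fin B.card) ι R} :
    (blockColumns H B).det ≠ 0 ↔ JointlyInjectiveOn H B := by
  rw [Ne, ← Matrix.exists_mulVec_eq_zero_iff]
  constructor
  · intro hdet c hc b hb
    by_contra hcb
    refine hdet ⟨fun jq => c (B.orderEmbOfFin rfl jq.2) jq.1, fun h => hcb ?_,
      (blockColumns_mulVec H B c).trans hc⟩
    obtain ⟨q, rfl⟩ : b ∈ Set.range (B.orderEmbOfFin rfl) := by
      rwa [Finset.range_orderEmbOfFin, Finset.mem_coe]
    exact funext fun j => congrFun h (j, q)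
  · rintro hH ⟨v, hv, hHv⟩
    obtain ⟨c, hc⟩ : ∃ c : α → ι → R, ∀ q, c (B.orderEmbOfFin rfl q) = fun j => v (j, q) :=
      ⟨_, (B.orderEmbOfFin rfl).injective.extend_apply (fun q j => v (j, q)) 0⟩
    have hcv : (fun jq : ι × Fin B.card => c (B.orderEmbOfFin rfl jq.2) jq.1) = v :=
      funext fun jq => congrFun (hc jq.2) jq.1
    refine hv (funext fun jq => ?_)
    rw [← hcv]
    exact congrFun (hH c (by rw [← blockColumns_mulVec, hcv, hHv]) _
      (B.orderEmbOfFin_mem rfl jq.2)) jq.1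

end BlockColumns

section PowerSums

variable {F ν ι : Type*} [Field F] [Fintype ι] [DecidableEq ι]

/-- The `p`-th power sum `∑ z ∈ S, M z Λ z ^ p c z`: the block of index `p` in the parity-check
equations of the nodes in `S`, when the parity-check matrix of `z` has the blocks `M z Λ z ^ p`. -/
def powerSum (M Λ : ν → Matrix ι ι F) (S : Finset ν) (c : ν → ι → F) (p : ℕ) : ι → F :=
  ∑ z ∈ S, (M z * Λ z ^ p).mulVec (c z)

/-- A word on `S` is determined by its first `|S|` power sums. -/
def PowerIndependentOn (M Λ : ν → Matrix ι ι F) (S : Finset ν) : Prop :=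
  ∀ c : ν → ι → F, (∀ p < S.card, powerSum M Λ S c p = 0) → ∀ z ∈ S, c z = 0

/-- The matrix with blocks `M Λ ^ p`, `p < t`, stacked on top of each other. -/
def powerCheck {R : Type*} [CommRing R] (t : ℕ) (M Λ : Matrix ι ι R) : Matrix (ι × Fin t) ι R :=
  fun ip j => (M * Λ ^ (ip.2 : ℕ)) ip.1 j

theorem powerCheck_mulVec {R : Type*} [CommRing R] (t : ℕ) (M Λ : Matrix ι ι R) (f : ι → R) (i : ι)
    (p : Fin t) : (powerCheck t M Λ).mulVec f (i, p) = (M * Λ ^ (p : ℕ)).mulVec f i :=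
  rfl

variable {M Λ : ν → Matrix ι ι F} {S B T : Finset ν}

theorem sum_powerCheck_mulVec_apply (t : ℕ) (c : ν → ι → F) (i : ι) (p : Fin t) :
    (∑ z ∈ S, (powerCheck t (M z) (Λ z)).mulVec (c z)) (i, p) = powerSum M Λ S c p i := by
  simp only [powerSum, Finset.sum_apply, powerCheck_mulVec]

theorem jointlyInjectiveOn_powerCheck_iff :
    JointlyInjectiveOn (fun z => powerCheck S.card (M z) (Λ z)) S ↔ PowerIndependentOn M Λ S := by
  refine forall_congr' fun c => imp_congr_left ⟨fun h p hp => funext fun i => ?_,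
    fun h => funext fun ip => ?_⟩
  · exact (sum_powerCheck_mulVec_apply _ c i ⟨p, hp⟩).symm.trans (congrFun h _)
  · exact (sum_powerCheck_mulVec_apply _ c ip.1 ip.2).trans (congrFun (h _ ip.2.2) _)

theorem powerIndependentOn_map {κ : Type*} (f : κ ↪ ν) {S : Finset κ} :
    PowerIndependentOn M Λ (S.map f) ↔ PowerIndependentOn (M ∘ f) (Λ ∘ f) S := by
  have powerSum_map (c : ν → ι → F) (p : ℕ) :
      powerSum M Λ (S.map f) c p = powerSum (M ∘ f) (Λ ∘ f) S (c ∘ f) p := Finset.sum_map ..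
  simp only [PowerIndependentOn, powerSum_map, Finset.card_map, Finset.forall_mem_map]
  refine ⟨fun h c hc z hz => ?_, fun h c hc z hz => h (c ∘ f) hc z hz⟩
  obtain ⟨c, rfl⟩ : ∃ c', c' ∘ f = c :=
    ⟨Function.extend f c 0, Function.extend_comp f.injective c 0⟩
  exact h c hc z hz

theorem powerSum_add (c d : ν → ι → F) (p : ℕ) :
    powerSum M Λ S (c + d) p = powerSum M Λ S c p + powerSum M Λ S d p := by
  simp only [powerSum, Pi.add_apply, Matrix.mulVec_add, Finset.sum_add_distrib]

theorem powerSum_finsetSum {κ : Type*} (s : Finset κ) (d : κ → ν → ι → F) (p : ℕ) :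
    powerSum M Λ S (∑ w ∈ s, d w) p = ∑ w ∈ s, powerSum M Λ S (d w) p := by
  simp only [powerSum, Finset.sum_apply, Matrix.mulVec_sum, Finset.sum_comm (s := s)]

theorem powerSum_mulVec_pow (c : ν → ι → F) (p q : ℕ) :
    powerSum M Λ S (fun z => (Λ z ^ p).mulVec (c z)) q = powerSum M Λ S c (p + q) := by
  simp only [powerSum, Matrix.mulVec_mulVec, mul_assoc, ← pow_add, add_comm]

theorem powerSum_mulVec {X : Matrix ι ι F} (hM : ∀ z ∈ S, Commute X (M z))
    (hΛ : ∀ z ∈ S, Commute X (Λ z)) (c : ν → ι → F) (p : ℕ) :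
    powerSum M Λ S (fun z => X.mulVec (c z)) p = X.mulVec (powerSum M Λ S c p) := by
  simp only [powerSum, Matrix.mulVec_sum, Matrix.mulVec_mulVec]
  refine Finset.sum_congr rfl fun z hz => ?_
  rw [((hM z hz).mul_right ((hΛ z hz).pow_right p)).eq]

theorem powerSum_union [DecidableEq ν] (hBT : Disjoint B T) (c : ν → ι → F) (p : ℕ) :
    powerSum M Λ (B ∪ T) c p = powerSum M Λ B c p + powerSum M Λ T c p :=
  Finset.sum_union hBT

theorem PowerIndependentOn.exists_powerSum_eq (h : PowerIndependentOn M Λ S) (f : ℕ → ι → F) :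
    ∃ d : ν → ι → F, ∀ p < S.card, powerSum M Λ S d p = f p := by
  obtain ⟨d, -, hd⟩ := (jointlyInjectiveOn_powerCheck_iff.2 h).exists_sum_mulVec_eq
    (by simp [mul_comm]) fun ip => f ip.2 ip.1
  exact ⟨d, fun p hp => funext fun i =>
    (sum_powerCheck_mulVec_apply _ d i ⟨p, hp⟩).symm.trans (congrFun hd _)⟩

/-- Two nodes whose pairs of matrices commute with each other and whose power matrices `Λ z`, `Λ w`
agree on no nonzero vector. -/
structure Transversal (M Λ : ν → Matrix ι ι F) (z w : ν) : Prop where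
  commute_left : Commute (M z) (M w)
  commute_left_right : Commute (M z) (Λ w)
  commute_right_left : Commute (Λ z) (M w)
  commute_right : Commute (Λ z) (Λ w)
  eq_zero_of_mulVec_eq : ∀ u, (Λ z).mulVec u = (Λ w).mulVec u → u = 0

theorem PowerIndependentOn.eq_zero_of_powerSum_eq_pow {w : ν} (hB : PowerIndependentOn M Λ B)
    (hw : ∀ z ∈ B, Transversal M Λ z w) {d : ν → ι → F} {v : ι → F}
    (hd : ∀ p ≤ B.card, powerSum M Λ B d p = (Λ w ^ p).mulVec v) : v = 0 := by
  have commute_M (z) (hz : z ∈ B) : Commute (-Λ w) (M z) :=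
    ((hw z hz).commute_left_right).symm.neg_left
  have commute_Λ (z) (hz : z ∈ B) : Commute (-Λ w) (Λ z) := ((hw z hz).commute_right).symm.neg_left
  -- The nodes `Λ z d z - Λ w d z` have vanishing power sums on `B`.
  have shifted (p) (hp : p < B.card) : powerSum M Λ B
      ((fun z => (Λ z ^ 1).mulVec (d z)) + fun z => (-Λ w).mulVec (d z)) p = 0 := by
    rw [powerSum_add, powerSum_mulVec_pow, powerSum_mulVec commute_M commute_Λ, hd _ hp.le,
      hd _ (by omega), Matrix.mulVec_mulVec, neg_mul, Matrix.neg_mulVec, add_comm 1 p, pow_succ',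
      add_neg_cancel]
  have d_eq_zero (z) (hz : z ∈ B) : d z = 0 := by
    refine (hw z hz).eq_zero_of_mulVec_eq _ (sub_eq_zero.1 ?_)
    simpa only [Pi.add_apply, pow_one, Matrix.neg_mulVec, ← sub_eq_add_neg] using hB _ shifted z hz
  have h0 := hd 0 (Nat.zero_le _)
  rw [pow_zero, Matrix.one_mulVec] at h0
  rw [← h0]
  exact Finset.sum_eq_zero fun z hz => by rw [d_eq_zero z hz, Matrix.mulVec_zero]

theorem PowerIndependentOn.powerSum_defect_eq_zero (hB : PowerIndependentOn M Λ B)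
    (h : ∀ z ∈ B, ∀ w ∈ T, Transversal M Λ z w) {c : ν → ι → F}
    (hc : ∀ p < B.card + T.card, powerSum M Λ B c p + powerSum M Λ T c p = 0)
    {d : ν → ν → ι → F} (hd : ∀ w, ∀ p < B.card, powerSum M Λ B (d w) p = (Λ w ^ p).mulVec (c w))
    {p : ℕ} (hp : p < T.card) :
    powerSum M Λ T (fun w => powerSum M Λ B (d w) B.card - (Λ w ^ B.card).mulVec (c w)) p = 0 := by
  -- `d w` simulates the node `w` by the nodes in `B`; `D` simulates all of `T`, shifted by `p`.
  let D : ν → ι → F := ∑ w ∈ T, fun z => (M w * Λ w ^ p).mulVec (d w z)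
  have powerSum_D (q : ℕ) : powerSum M Λ B D q =
      ∑ w ∈ T, (M w * Λ w ^ p).mulVec (powerSum M Λ B (d w) q) := by
    rw [powerSum_finsetSum]
    refine Finset.sum_congr rfl fun w hw => powerSum_mulVec (fun z hz => ?_) (fun z hz => ?_) _ _
    · exact (h z hz w hw).commute_left.symm.mul_left
        ((h z hz w hw).commute_left_right.symm.pow_left p)
    · exact (h z hz w hw).commute_right_left.symm.mul_left
        ((h z hz w hw).commute_right.symm.pow_left p)
  have powerSum_T (q : ℕ) : powerSum M Λ T c (p + q) =
      ∑ w ∈ T, (M w * Λ w ^ p).mulVec ((Λ w ^ q).mulVec (c w)) := by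
    simp only [powerSum, Matrix.mulVec_mulVec, mul_assoc, ← pow_add]
  have eliminated (z) (hz : z ∈ B) : (D + fun z => (Λ z ^ p).mulVec (c z)) z = 0 := by
    refine hB _ (fun q hq => ?_) z hz
    rw [powerSum_add, powerSum_mulVec_pow, powerSum_D, add_comm,
      Finset.sum_congr rfl fun w _ => by rw [hd w q hq], ← powerSum_T]
    exact hc _ (by omega)
  have powerSum_eliminated :
      powerSum M Λ B (D + fun z => (Λ z ^ p).mulVec (c z)) B.card = 0 :=
    Finset.sum_eq_zero fun z hz => by rw [eliminated z hz, Matrix.mulVec_zero]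
  rw [powerSum_add, powerSum_mulVec_pow, powerSum_D,
    eq_neg_of_add_eq_zero_left (hc (p + B.card) (by omega)), powerSum_T, ← sub_eq_add_neg,
    ← Finset.sum_sub_distrib] at powerSum_eliminated
  simp only [← Matrix.mulVec_sub] at powerSum_eliminated
  exact powerSum_eliminated

theorem PowerIndependentOn.eq_zero_of_powerSum_add_eq_zero (hB : PowerIndependentOn M Λ B)
    (hT : PowerIndependentOn M Λ T) (h : ∀ z ∈ B, ∀ w ∈ T, Transversal M Λ z w) {c : ν → ι → F}
    (hc : ∀ p < B.card + T.card, powerSum M Λ B c p + powerSum M Λ T c p = 0) :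
    ∀ w ∈ T, c w = 0 := by
  choose d hd using fun w => hB.exists_powerSum_eq fun p => (Λ w ^ p).mulVec (c w)
  refine fun w hw => hB.eq_zero_of_powerSum_eq_pow (fun z hz => h z hz w hw) (d := d w)
    fun p hp => ?_
  rcases hp.lt_or_eq with hp | rfl
  · exact hd w p hp
  · exact sub_eq_zero.1 (hT _ (fun p => hB.powerSum_defect_eq_zero h hc hd) w hw)

theorem PowerIndependentOn.union [DecidableEq ν] (hB : PowerIndependentOn M Λ B)
    (hT : PowerIndependentOn M Λ T) (hBT : Disjoint B T)
    (h : ∀ z ∈ B, ∀ w ∈ T, Transversal M Λ z w) : PowerIndependentOn M Λ (B ∪ T) := by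
  intro c hc
  simp only [powerSum_union hBT, Finset.card_union_of_disjoint hBT] at hc
  have c_eq_zero := hB.eq_zero_of_powerSum_add_eq_zero hT h hc
  have powerSum_T (p : ℕ) : powerSum M Λ T c p = 0 :=
    Finset.sum_eq_zero fun w hw => by rw [c_eq_zero w hw, Matrix.mulVec_zero]
  intro z hz
  rcases Finset.mem_union.1 hz with hz | hz
  · exact hB c (fun p hp => by simpa only [powerSum_T, add_zero] using hc p (by omega)) z hz
  · exact c_eq_zero z hz

theorem powerIndependentOn_of_filter {κ : Type*} [DecidableEq κ] (g : ν → κ)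
    (hfiber : ∀ a, PowerIndependentOn M Λ (S.filter (g · = a)))
    (hcross : ∀ z ∈ S, ∀ w ∈ S, g z ≠ g w → Transversal M Λ z w) : PowerIndependentOn M Λ S := by
  classical
  suffices ∀ A : Finset κ, PowerIndependentOn M Λ (S.filter (g · ∈ A)) by
    simpa only [Finset.filter_true_of_mem fun _ hz => Finset.mem_image_of_mem g hz]
      using this (S.image g)
  intro A
  induction A using Finset.induction_on with
  | empty => simp [PowerIndependentOn]
  | insert a A ha ih =>
    simp only [Finset.mem_insert, Finset.filter_or]
    refine (hfiber a).union ih (Finset.disjoint_filter.2 ?_) ?_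
    · rintro z - rfl
      exact ha
    · simp only [Finset.mem_filter]
      rintro z ⟨hz, rfl⟩ w ⟨hw, hwA⟩
      exact hcross z hz w hw fun h => ha (h ▸ hwA)

end PowerSums

section DigitMatrices

variable {R F G σ ν : Type*} [CommRing R] [Field F] [Fintype G] [DecidableEq G] [DecidableEq σ]

/-- The matrix that applies `K` to the digit at position `a`. -/
def digitMatrix (a : G) (K : Matrix σ σ R) : Matrix (G → σ) (G → σ) R :=
  fun i j => if ∀ u, u ≠ a → i u = j u then K (i a) (j a) else 0

theorem digitMatrix_one (a : G) : digitMatrix a (1 : Matrix σ σ R) = 1 := by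
  ext i j
  by_cases h : ∀ u, u ≠ a → i u = j u
  · have hij : i a = j a ↔ i = j :=
      ⟨fun ha => (Function.eq_update_iff.2 ⟨ha, h⟩).trans (Function.update_eq_self a j),
        fun hij => congrFun hij a⟩
    simp only [digitMatrix, if_pos h, Matrix.one_apply, hij]
  · have hij : i ≠ j := fun hij => h fun u _ => congrFun hij u
    simp only [digitMatrix, if_neg h, Matrix.one_apply_ne hij]

variable [Fintype σ]

theorem digitMatrix_mulVec (a : G) (K : Matrix σ σ R) (f : (G → σ) → R) (i : G → σ) :
    (digitMatrix a K).mulVec f i = ∑ e, K (i a) e * f (Function.update i a e) := by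
  symm
  refine Finset.sum_of_injOn (Function.update i a) (Function.update_injective i a).injOn
    (fun _ _ => Finset.mem_coe.2 (Finset.mem_univ _)) (fun j _ hj => ?_) fun e _ => ?_
  · refine mul_eq_zero_of_left (if_neg fun hij => hj ⟨j a, by simp, ?_⟩) _
    exact Function.update_eq_iff.2 ⟨rfl, hij⟩
  · have hi : ∀ u, u ≠ a → i u = Function.update i a e u := fun u hu =>
      (Function.update_of_ne hu e i).symm
    simp only [digitMatrix, if_pos hi, Function.update_self]

theorem digitMatrix_mulVec_update (a : G) (K : Matrix σ σ R) (f : (G → σ) → R) (i : G → σ) (e : σ) :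
    (digitMatrix a K).mulVec f (Function.update i a e) =
      K.mulVec (fun e' => f (Function.update i a e')) e := by
  simp only [digitMatrix_mulVec, Function.update_self, Function.update_idem]
  rfl

theorem digitMatrix_diagonal_mulVec (a : G) (x : σ → R) (f : (G → σ) → R) (i : G → σ) :
    (digitMatrix a (Matrix.diagonal x)).mulVec f i = x (i a) * f i := by
  have h := digitMatrix_mulVec_update a (Matrix.diagonal x) f i (i a)
  rwa [Matrix.mulVec_diagonal, Function.update_eq_self] at h

theorem digitMatrix_mul (a : G) (K L : Matrix σ σ R) :
    digitMatrix a (K * L) = digitMatrix a K * digitMatrix a L := by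
  refine Matrix.mulVec_injective (funext fun f => funext fun i => ?_)
  rw [← Function.update_eq_self a i]
  simp only [← Matrix.mulVec_mulVec, digitMatrix_mulVec_update]

theorem digitMatrix_pow (a : G) (K : Matrix σ σ R) (p : ℕ) :
    digitMatrix a (K ^ p) = digitMatrix a K ^ p := by
  induction p with
  | zero => rw [pow_zero, pow_zero, digitMatrix_one]
  | succ p ih => rw [pow_succ, pow_succ, digitMatrix_mul, ih]

theorem digitMatrix_commute {a a' : G} (h : a ≠ a') (K K' : Matrix σ σ R) :
    Commute (digitMatrix a K) (digitMatrix a' K') := by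
  refine Matrix.mulVec_injective (funext fun f => funext fun i => ?_)
  simp only [← Matrix.mulVec_mulVec, digitMatrix_mulVec, Function.update_of_ne h,
    Function.update_of_ne h.symm, Finset.mul_sum]
  rw [Finset.sum_comm]
  refine Finset.sum_congr rfl fun e _ => Finset.sum_congr rfl fun e' _ => ?_
  rw [Function.update_comm h, mul_left_comm]

variable {M Λ : ν → Matrix σ σ F} {S : Finset ν}

theorem powerSum_digitMatrix_update (a : G) (c : ν → (G → σ) → F) (p : ℕ) (i : G → σ) (e : σ) :
    powerSum (fun z => digitMatrix a (M z)) (fun z => digitMatrix a (Λ z)) S c p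
        (Function.update i a e) =
      powerSum M Λ S (fun z e' => c z (Function.update i a e')) p e := by
  simp only [powerSum, ← digitMatrix_pow, ← digitMatrix_mul, Finset.sum_apply,
    digitMatrix_mulVec_update]

theorem powerIndependentOn_digitMatrix_iff (a : G) :
    PowerIndependentOn (fun z => digitMatrix a (M z)) (fun z => digitMatrix a (Λ z)) S ↔
      PowerIndependentOn M Λ S := by
  constructor
  · intro h c hc z hz
    refine funext fun e => congrFun (h (fun z i => c z (i a)) (fun p hp => ?_) z hz) fun _ => e
    funext i
    rw [← Function.update_eq_self a i, powerSum_digitMatrix_update]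
    simp only [Function.update_self]
    exact congrFun (hc p hp) (i a)
  · intro h c hc z hz
    refine funext fun i => ?_
    have hslice := h (fun z e => c z (Function.update i a e)) (fun p hp => funext fun e => by
      rw [← powerSum_digitMatrix_update, hc p hp]; rfl) z hz
    exact (congrArg (c z) (Function.update_eq_self a i)).symm.trans (congrFun hslice (i a))

end DigitMatrices

section LocalConstraint

variable {F G : Type*} [Field F] {s : ℕ}

/-- The matrix that subtracts all other coordinates from coordinate `b`; it is the identity for
`b = s`. -/
def foldMatrix (R : Type*) [CommRing R] {s : ℕ} (b : Fin (s + 1)) : Matrix (Fin s) (Fin s) R :=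
  fun i e => if i = e then 1 else if i.castSucc = b then -1 else 0

theorem foldMatrix_of_castSucc_ne {b : Fin (s + 1)} {e : Fin s} (h : e.castSucc ≠ b) (e' : Fin s) :
    foldMatrix F b e e' = if e = e' then 1 else 0 := by
  simp only [foldMatrix, if_neg h]

theorem blockMatrix_eq_powerCheck [Fintype G] [DecidableEq G] (t : ℕ) (a : G) (b : Fin (s + 1))
    (x : Fin s → F) : blockMatrix t a b x =
      powerCheck t (digitMatrix a (foldMatrix F b)) (digitMatrix a (Matrix.diagonal x)) := by
  funext ⟨i, p⟩ j
  simp only [powerCheck, ← digitMatrix_pow, ← digitMatrix_mul, Matrix.diagonal_pow,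
    Matrix.mul_diagonal, digitMatrix, blockMatrix, foldMatrix, Pi.pow_apply]
  by_cases hij : i = j
  · simp [hij]
  by_cases hrest : ∀ u, u ≠ a → i u = j u
  · have ha : i a ≠ j a := fun ha => hij (funext fun u => by
      by_cases hu : u = a
      · exact hu ▸ ha
      · exact hrest u hu)
    by_cases hb : (i a).castSucc = b
    · have hjb : (j a).castSucc ≠ b := fun h => ha (Fin.castSucc_injective _ (hb.trans h.symm))
      simp [hij, ha, hb, hjb]
    · simp [hij, ha, hb]
  · simp [hij, hrest]

/-- The local constraint on a set `B` of in-group indices, in the coordinates of a single digit. -/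
def LocallyIndependent (x : Fin (s + 1) → Fin s → F) (B : Finset (Fin (s + 1))) : Prop :=
  PowerIndependentOn (foldMatrix F) (fun b => Matrix.diagonal (x b)) B

theorem det_localMatrix_ne_zero_iff {n : ℕ} (lam : Scalars F n s) (a : Fin (numGroups n s))
    (B : Finset (Fin (s + 1))) :
    (localMatrix lam a B).det ≠ 0 ↔ LocallyIndependent (fun b e => lam (a, b, e)) B := by
  have localMatrix_eq : localMatrix lam a B = blockColumns
      (fun b => blockMatrix B.card a b fun e => lam (a, b, e)) B := rfl
  rw [localMatrix_eq, det_blockColumns_ne_zero_iff]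
  simp only [blockMatrix_eq_powerCheck]
  rw [jointlyInjectiveOn_powerCheck_iff, powerIndependentOn_digitMatrix_iff]
  rfl

end LocalConstraint

section NodeKinds

variable {F G : Type*} {s : ℕ}

/-- The nodes of the code and of the reduced codes: `grouped a b` is a node with in-group index `b`
in a group at digit position `a`, and `scalar x` a node with parity-check matrix `I ⊗ L`, where `L`
is the column of powers of `x`. -/
inductive NodeKind (F G : Type*) (s : ℕ)
  | grouped (a : G) (b : Fin (s + 1))
  | scalar (x : F)

namespace NodeKind

/-- The scalar of a node in the equations of index `i`. -/
def scalarAt (lam : G × Fin (s + 1) × Fin s → F) (i : G → Fin s) : NodeKind F G s → F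
  | grouped a b => lam (a, b, i a)
  | scalar x => x

/-- The group of a node; a node `scalar x` forms a group of its own. -/
def group : NodeKind F G s → G ⊕ F
  | grouped a _ => Sum.inl a
  | scalar x => Sum.inr x

variable {lam : G × Fin (s + 1) × Fin s → F}

theorem scalarAt_ne_of_group_ne (hlam : Function.Injective lam) {z w : NodeKind F G s}
    (hz : ∀ y, z ≠ scalar (lam y)) (hw : ∀ y, w ≠ scalar (lam y)) (h : z.group ≠ w.group)
    (i : G → Fin s) : z.scalarAt lam i ≠ w.scalarAt lam i := by
  cases z with
  | grouped a b =>
    cases w with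
    | grouped a' b' => exact fun heq => h (congrArg Sum.inl (congrArg Prod.fst (hlam heq)))
    | scalar y => exact fun heq => hw _ (congrArg scalar heq.symm)
  | scalar x =>
    cases w with
    | grouped a' b' => exact fun heq => hz _ (congrArg scalar heq)
    | scalar y => exact fun heq => h (congrArg Sum.inr heq)

variable [Field F] [Fintype G] [DecidableEq G]

/-- The coefficient matrix of a node in the power sums. -/
def coeff : NodeKind F G s → Matrix (G → Fin s) (G → Fin s) F
  | grouped a b => digitMatrix a (foldMatrix F b)
  | scalar _ => 1

/-- The matrix of a node whose powers occur in the power sums. -/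
def base (lam : G × Fin (s + 1) × Fin s → F) : NodeKind F G s → Matrix (G → Fin s) (G → Fin s) F
  | grouped a b => digitMatrix a (Matrix.diagonal fun e => lam (a, b, e))
  | scalar x => x • 1

theorem base_mulVec (z : NodeKind F G s) (u : (G → Fin s) → F) (i : G → Fin s) :
    (base lam z).mulVec u i = z.scalarAt lam i * u i := by
  cases z with
  | grouped a b => exact digitMatrix_diagonal_mulVec ..
  | scalar x => rw [base, Matrix.smul_mulVec, Matrix.one_mulVec]; rfl

theorem transversal_of_group_ne (hlam : Function.Injective lam) {z w : NodeKind F G s}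
    (hz : ∀ y, z ≠ scalar (lam y)) (hw : ∀ y, w ≠ scalar (lam y)) (h : z.group ≠ w.group) :
    Transversal coeff (base lam) z w := by
  have separated (u : (G → Fin s) → F) (hu : (base lam z).mulVec u = (base lam w).mulVec u) :
      u = 0 := funext fun i => by
    have hi := congrFun hu i
    rw [base_mulVec, base_mulVec] at hi
    by_contra hui
    exact scalarAt_ne_of_group_ne hlam hz hw h i (mul_right_cancel₀ hui hi)
  cases z with
  | grouped a b =>
    cases w with
    | grouped a' b' =>
      have ha : a ≠ a' := fun heq => h (congrArg Sum.inl heq)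
      exact ⟨digitMatrix_commute ha _ _, digitMatrix_commute ha _ _, digitMatrix_commute ha _ _,
        digitMatrix_commute ha _ _, separated⟩
    | scalar y =>
      exact ⟨.one_right _, (Commute.one_right _).smul_right y, .one_right _,
        (Commute.one_right _).smul_right y, separated⟩
  | scalar x =>
    exact ⟨.one_left _, .one_left _, (Commute.one_left _).smul_left x,
      (Commute.one_left _).smul_left x, separated⟩

theorem powerIndependentOn_of_subset_singleton_scalar {S : Finset (NodeKind F G s)} {x : F}
    (hS : S ⊆ {scalar x}) : PowerIndependentOn coeff (base lam) S := by
  rcases Finset.subset_singleton_iff.1 hS with rfl | rfl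
  · simp [PowerIndependentOn]
  · intro c hc z hz
    have h0 := hc 0 Nat.one_pos
    rw [Finset.mem_singleton.1 hz]
    rwa [powerSum, Finset.sum_singleton, pow_zero, mul_one, coeff, Matrix.one_mulVec] at h0

theorem powerIndependentOn (hlam : Function.Injective lam)
    (hloc : ∀ a B, LocallyIndependent (fun b e => lam (a, b, e)) B) {S : Finset (NodeKind F G s)}
    (hS : ∀ y, scalar (lam y) ∉ S) : PowerIndependentOn coeff (base lam) S := by
  classical
  refine powerIndependentOn_of_filter group (fun a => ?_) fun z hz w hw =>
    transversal_of_group_ne hlam (fun y h => hS y (h ▸ hz)) (fun y h => hS y (h ▸ hw))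
  rcases a with a | x
  · let grouped_a : Fin (s + 1) ↪ NodeKind F G s := ⟨grouped a, fun b b' h => by injection h⟩
    have fiber_eq : S.filter (group · = Sum.inl a) =
        (Finset.univ.filter (grouped a · ∈ S)).map grouped_a := by
      refine Finset.Subset.antisymm (fun z hz => ?_) fun z hz => ?_
      · obtain ⟨hzS, hza⟩ := Finset.mem_filter.1 hz
        cases z with
        | grouped a' b =>
          obtain rfl := Sum.inl_injective hza
          exact Finset.mem_map.2 ⟨b, Finset.mem_filter.2 ⟨Finset.mem_univ b, hzS⟩, rfl⟩
        | scalar x => exact absurd hza Sum.inr_ne_inl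
      · obtain ⟨b, hb, rfl⟩ := Finset.mem_map.1 hz
        exact Finset.mem_filter.2 ⟨(Finset.mem_filter.1 hb).2, rfl⟩
    rw [fiber_eq, powerIndependentOn_map]
    exact (powerIndependentOn_digitMatrix_iff a).2 (hloc a _)
  · refine powerIndependentOn_of_subset_singleton_scalar (x := x) fun z hz => ?_
    cases z with
    | grouped a b => exact absurd (Finset.mem_filter.1 hz).2 Sum.inl_ne_inr
    | scalar y => rw [Sum.inr_injective (Finset.mem_filter.1 hz).2, Finset.mem_singleton]

/-- The parity-check matrix of a node. -/
def check (lam : G × Fin (s + 1) × Fin s → F) (r : ℕ) (z : NodeKind F G s) :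
    Matrix ((G → Fin s) × Fin r) (G → Fin s) F :=
  powerCheck r z.coeff (z.base lam)

theorem check_grouped (r : ℕ) (a : G) (b : Fin (s + 1)) :
    (grouped a b).check lam r = blockMatrix r a b fun e => lam (a, b, e) :=
  (blockMatrix_eq_powerCheck ..).symm

theorem check_scalar (r : ℕ) (x : F) : (scalar x).check lam r = diagMatrix (G → Fin s) r x := by
  funext ip j
  simp [check, powerCheck, coeff, base, diagMatrix, smul_pow, Matrix.one_apply]

theorem jointlyInjectiveOn_check {ν : Type*} (hlam : Function.Injective lam)
    (hloc : ∀ a B, LocallyIndependent (fun b e => lam (a, b, e)) B)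
    {τ : ν → NodeKind F G s} (hτ : Function.Injective τ) (hscalar : ∀ z y, τ z ≠ scalar (lam y))
    (S : Finset ν) : JointlyInjectiveOn (fun z => (τ z).check lam S.card) S := by
  have independent : PowerIndependentOn coeff (base lam) (S.map ⟨τ, hτ⟩) :=
    powerIndependentOn hlam hloc fun y hy => by
      obtain ⟨z, -, hz⟩ := Finset.mem_map.1 hy
      exact hscalar z y hz
  have independent_comp := (powerIndependentOn_map ⟨τ, hτ⟩).1 independent
  exact jointlyInjectiveOn_powerCheck_iff.2 independent_comp

theorem isMDSArrayCode_check {ν : Type*} [Fintype ν] (hlam : Function.Injective lam)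
    (hloc : ∀ a B, LocallyIndependent (fun b e => lam (a, b, e)) B)
    {τ : ν → NodeKind F G s} (hτ : Function.Injective τ) (hscalar : ∀ z y, τ z ≠ scalar (lam y))
    {ε : ν → F} (hε : ∀ z, ε z ≠ 0) {k r : ℕ} (hkr : k + r = Fintype.card ν) :
    IsMDSArrayCode (arrayCode fun z => ε z • (τ z).check lam r) k := by
  have card_rows : Fintype.card ((G → Fin s) × Fin r) = r * Fintype.card (G → Fin s) := by
    rw [Fintype.card_prod, Fintype.card_fin, mul_comm]
  refine isMDSArrayCode_of_jointlyInjectiveOn hkr card_rows fun S hS => ?_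
  subst hS
  exact (jointlyInjectiveOn_check hlam hloc hτ hscalar S).smul fun z _ => hε z

end NodeKind

end NodeKinds

section Nodes

variable {F : Type*} {n s : ℕ}

theorem node_ext {j j' : Fin n} (hg : nodeGroup s j = nodeGroup s j')
    (hp : nodePos s j = nodePos s j') : j = j' := by
  have div_eq : (j : ℕ) / (s + 1) = j' / (s + 1) := congrArg Fin.val hg
  have mod_eq : (j : ℕ) % (s + 1) = j' % (s + 1) := congrArg Fin.val hp
  ext
  rw [← Nat.div_add_mod (j : ℕ) (s + 1), div_eq, mod_eq, Nat.div_add_mod]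

theorem card_reducedNode (h : Fin n) : Fintype.card (ReducedNode s h) = n + s - 1 := by
  have hn := h.pos
  rw [Fintype.card_sum, Fintype.card_subtype_compl, Fintype.card_fin, Fintype.card_fin,
    Fintype.card_unique]
  omega

/-- The kind of a node once the digit at position `a` is left out: outside group `a` the group is
kept, and in group `a` only the scalar with the given digit remains. -/
def kindWithoutGroup (lam : Scalars F n s) (a : Fin (numGroups n s))
    (y : Fin (numGroups n s) × Fin (s + 1) × Fin s) :
    NodeKind F {u : Fin (numGroups n s) // u ≠ a} s :=
  if hu : y.1 ≠ a then .grouped ⟨y.1, hu⟩ y.2.1 else .scalar (lam y)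

/-- The scalars of the groups other than `a`. -/
def scalarsWithoutGroup (lam : Scalars F n s) (a : Fin (numGroups n s)) :
    {u : Fin (numGroups n s) // u ≠ a} × Fin (s + 1) × Fin s → F :=
  fun y => lam (y.1, y.2)

/-- The position of the scalar that a reduced node keeps, when a node `z ≠ h` of the group of `h`
keeps the one with digit `digit z`. -/
def reducedAddress (h : Fin n) (digit : Fin n → Fin s) :
    ReducedNode s h → Fin (numGroups n s) × Fin (s + 1) × Fin s
  | Sum.inl z => (nodeGroup s z.1, nodePos s z.1, digit z)
  | Sum.inr e => (nodeGroup s h, nodePos s h, e)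

variable {lam : Scalars F n s} {a : Fin (numGroups n s)}

theorem injective_scalarsWithoutGroup (hlam : Function.Injective lam) :
    Function.Injective (scalarsWithoutGroup lam a) := fun y y' h => by
  have hyy : ((y.1 : Fin (numGroups n s)), y.2) = (↑y'.1, y'.2) := hlam h
  exact Prod.ext (Subtype.ext (Prod.mk.inj hyy).1) (Prod.mk.inj hyy).2

theorem eq_of_kindWithoutGroup_eq (hlam : Function.Injective lam)
    {y y' : Fin (numGroups n s) × Fin (s + 1) × Fin s}
    (h : kindWithoutGroup lam a y = kindWithoutGroup lam a y') :
    y.1 = y'.1 ∧ y.2.1 = y'.2.1 ∧ (y.1 = a → y = y') := by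
  unfold kindWithoutGroup at h
  split_ifs at h with hy hy'
  · injection h with hg hp
    exact ⟨congrArg Subtype.val hg, hp, fun h => absurd h hy⟩
  · injection h with h
    obtain rfl := hlam h
    exact ⟨rfl, rfl, fun _ => rfl⟩

theorem kindWithoutGroup_ne_scalar (hlam : Function.Injective lam)
    (y : Fin (numGroups n s) × Fin (s + 1) × Fin s)
    (y' : {u : Fin (numGroups n s) // u ≠ a} × Fin (s + 1) × Fin s) :
    kindWithoutGroup lam a y ≠ .scalar (scalarsWithoutGroup lam a y') := by
  intro h
  unfold kindWithoutGroup at h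
  split_ifs at h with hy
  injection h with h
  exact hy ((congrArg Prod.fst (hlam h)).trans_ne y'.1.2)

theorem injective_kindWithoutGroup_reducedAddress (hlam : Function.Injective lam) (h : Fin n)
    (digit : Fin n → Fin s) :
    Function.Injective fun z =>
      kindWithoutGroup lam (nodeGroup s h) (reducedAddress h digit z) := by
  rintro (z | e) (z' | e') hzz <;> obtain ⟨hg, hp, heq⟩ := eq_of_kindWithoutGroup_eq hlam hzz
  · exact congrArg Sum.inl (Subtype.ext (node_ext hg hp))
  · exact absurd (node_ext hg hp) z.2
  · exact absurd (node_ext hg hp).symm z'.2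
  · exact congrArg Sum.inr (congrArg (·.2.2) (heq rfl))

end Nodes

section ReducedCodes

variable {F : Type*} [Field F] {n s : ℕ} {lam : Scalars F n s} {k : ℕ}

theorem Admissible.locallyIndependent (hlam : Admissible lam) (a : Fin (numGroups n s))
    (B : Finset (Fin (s + 1))) : LocallyIndependent (fun b e => lam (a, b, e)) B :=
  (det_localMatrix_ne_zero_iff lam a B).1 (hlam.2 a B)

theorem Admissible.isMDSArrayCode_secondCode (hlam : Admissible lam) (hk : k ≤ n) :
    IsMDSArrayCode (secondCode lam (n - k)) k := by
  have mds := NodeKind.isMDSArrayCode_check hlam.1 hlam.locallyIndependent (r := n - k) (k := k)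
    (τ := fun j : Fin n => .grouped (nodeGroup s j) (nodePos s j)) (ε := fun _ => 1)
    (fun j j' h => by injection h with hg hp; exact node_ext hg hp) (fun _ _ h => by injection h)
    (fun _ => one_ne_zero) (by rw [Fintype.card_fin]; omega)
  simp only [one_smul, NodeKind.check_grouped] at mds
  exact mds

theorem check_kindWithoutGroup (r : ℕ) (a : Fin (numGroups n s))
    (y : Fin (numGroups n s) × Fin (s + 1) × Fin s) :
    (kindWithoutGroup lam a y).check (scalarsWithoutGroup lam a) r =
      if hu : y.1 ≠ a then blockMatrix r ⟨y.1, hu⟩ y.2.1 fun e => lam (y.1, y.2.1, e)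
      else diagMatrix (RestIndex a) r (lam y) := by
  unfold kindWithoutGroup
  split_ifs with hu
  · exact NodeKind.check_grouped ..
  · exact NodeKind.check_scalar ..

theorem Admissible.isMDSArrayCode_reducedAddress (hlam : Admissible lam) (hs : 0 < s)
    (hk : k ≤ n) (h : Fin n) (digit : Fin n → Fin s) {ε : ReducedNode s h → F}
    (hε : ∀ z, ε z ≠ 0) :
    IsMDSArrayCode (arrayCode fun z => ε z •
      (kindWithoutGroup lam (nodeGroup s h) (reducedAddress h digit z)).check
        (scalarsWithoutGroup lam (nodeGroup s h)) (n - k)) (k + s - 1) := by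
  have card_eq : k + s - 1 + (n - k) = Fintype.card (ReducedNode s h) := by
    have hn := h.pos
    rw [card_reducedNode]
    omega
  have hloc (a) (B) : LocallyIndependent
      (fun b e => scalarsWithoutGroup lam (nodeGroup s h) (a, b, e)) B :=
    hlam.locallyIndependent a.1 B
  exact NodeKind.isMDSArrayCode_check (injective_scalarsWithoutGroup hlam.1) hloc
    (injective_kindWithoutGroup_reducedAddress hlam.1 h digit)
    (fun _ => kindWithoutGroup_ne_scalar hlam.1 _) hε card_eq

theorem Admissible.isMDSArrayCode_reducedCheckFirst (hlam : Admissible lam) (hk : k ≤ n)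
    (h : Fin n) (b : Fin s) (hb : nodePos s h = b.castSucc) :
    IsMDSArrayCode (arrayCode (reducedCheckFirst lam (n - k) h b)) (k + s - 1) := by
  have mds := hlam.isMDSArrayCode_reducedAddress b.pos hk h (fun _ => b)
    (ε := Sum.elim (fun _ => 1) fun e => if e = b then 1 else -1) (by
      rintro (_ | e)
      · exact one_ne_zero
      · rw [Sum.elim_inr]
        split_ifs <;> simp)
  convert mds using 2
  funext z
  rw [check_kindWithoutGroup]
  rcases z with z | e
  · rw [Sum.elim_inl, one_smul]
    by_cases hz : nodeGroup s z.1 = nodeGroup s h <;> simp [reducedCheckFirst, reducedAddress, hz]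
  · by_cases he : e = b <;> simp [reducedCheckFirst, reducedAddress, he, hb]

theorem Admissible.isMDSArrayCode_reducedCheckLast (hlam : Admissible lam) (hs : 0 < s)
    (hk : k ≤ n) (h : Fin n) (hh : nodePos s h = Fin.last s) :
    IsMDSArrayCode (arrayCode (reducedCheckLast lam (n - k) h)) (k + s - 1) := by
  have mds := hlam.isMDSArrayCode_reducedAddress hs hk h
    (fun j => if hj : (nodePos s j : ℕ) < s then ⟨nodePos s j, hj⟩ else ⟨0, hs⟩)
    (ε := fun _ => 1) (fun _ => one_ne_zero)
  convert mds using 2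
  funext z
  rw [check_kindWithoutGroup, one_smul]
  rcases z with z | e
  · by_cases hz : nodeGroup s z.1 = nodeGroup s h
    · have hlt : (nodePos s z.1 : ℕ) < s :=
        Fin.val_lt_last fun h' => z.2 (node_ext hz (h'.trans hh.symm))
      simp [reducedCheckLast, reducedAddress, hz, hlt]
    · simp [reducedCheckLast, reducedAddress, hz]
  · simp [reducedCheckLast, reducedAddress, hh]

end ReducedCodes

section InsertDigit

variable {n s : ℕ} {a : Fin (numGroups n s)}

theorem insertDigit_self (e : Fin s) (x : RestIndex a) : insertDigit a e x a = e := by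
  simp [insertDigit, Equiv.funSplitAt_symm_apply]

theorem insertDigit_of_ne (e : Fin s) (x : RestIndex a) {u : Fin (numGroups n s)} (hu : u ≠ a) :
    insertDigit a e x u = x ⟨u, hu⟩ := by
  simp [insertDigit, Equiv.funSplitAt_symm_apply, hu]

theorem insertDigit_restrict (i : SymbolIndex n s) : insertDigit a (i a) (fun u => i u) = i :=
  (Equiv.funSplitAt a (Fin s)).symm_apply_apply i

theorem insertDigit_inj {e e' : Fin s} {x x' : RestIndex a} :
    insertDigit a e x = insertDigit a e' x' ↔ e = e' ∧ x = x' := by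
  rw [insertDigit, insertDigit, Equiv.apply_eq_iff_eq, Prod.mk.injEq]

theorem update_insertDigit_self (e e' : Fin s) (x : RestIndex a) :
    Function.update (insertDigit a e x) a e' = insertDigit a e' x := by
  refine Function.update_eq_iff.2 ⟨(insertDigit_self e' x).symm, fun u hu => ?_⟩
  rw [insertDigit_of_ne e x hu, insertDigit_of_ne e' x hu]

theorem update_insertDigit_of_ne (e e' : Fin s) (x : RestIndex a) {u : Fin (numGroups n s)}
    (hu : u ≠ a) : Function.update (insertDigit a e x) u e' =
      insertDigit a e (Function.update x ⟨u, hu⟩ e') := by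
  refine Function.update_eq_iff.2 ⟨?_, fun v hv => ?_⟩
  · rw [insertDigit_of_ne _ _ hu, Function.update_self]
  by_cases hva : v = a
  · rw [hva, insertDigit_self, insertDigit_self]
  · have hvu : (⟨v, hva⟩ : {v // v ≠ a}) ≠ ⟨u, hu⟩ := fun h => hv (congrArg Subtype.val h)
    rw [insertDigit_of_ne _ _ hva, insertDigit_of_ne _ _ hva, Function.update_of_ne hvu]

theorem ncard_range_insertDigit (a : Fin (numGroups n s)) (b : Fin s) :
    (Set.range (insertDigit a b)).ncard = Fintype.card (RestIndex a) := by
  rw [Set.ncard_range_of_injective fun x x' hx => (insertDigit_inj.1 hx).2,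
    Nat.card_eq_fintype_card]

theorem card_symbolIndex : Fintype.card (SymbolIndex n s) = s ^ (n ⌈/⌉ (s + 1)) := by
  rw [Fintype.card_fun, Fintype.card_fin, Fintype.card_fin, numGroups]

theorem card_restIndex_mul (a : Fin (numGroups n s)) :
    Fintype.card (RestIndex a) * s = s ^ (n ⌈/⌉ (s + 1)) := by
  rw [← card_symbolIndex, Fintype.card_congr (Equiv.funSplitAt a (Fin s)), Fintype.card_prod,
    Fintype.card_fin, mul_comm]

end InsertDigit

section ReducedParityChecks

variable {F : Type*} [Field F] {n s : ℕ} {a : Fin (numGroups n s)}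

theorem diagMatrix_mulVec {X : Type*} [DecidableEq X] [Fintype X] (t : ℕ) (x : F) (f : X → F)
    (i : X) (p : Fin t) : (diagMatrix X t x).mulVec f (i, p) = x ^ (p : ℕ) * f i := by
  simp [Matrix.mulVec, dotProduct, diagMatrix]

theorem blockMatrix_mulVec {G : Type*} [Fintype G] [DecidableEq G] (t : ℕ) (a : G)
    (b : Fin (s + 1)) (x : Fin s → F) (f : (G → Fin s) → F) (i : G → Fin s) (p : Fin t) :
    (blockMatrix t a b x).mulVec f (i, p) =
      ∑ e, foldMatrix F b (i a) e * (x e ^ (p : ℕ) * f (Function.update i a e)) := by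
  rw [blockMatrix_eq_powerCheck, powerCheck_mulVec, ← digitMatrix_pow, Matrix.diagonal_pow,
    ← Matrix.mulVec_mulVec, digitMatrix_mulVec]
  simp only [digitMatrix_diagonal_mulVec, Function.update_self, Pi.pow_apply]

theorem blockMatrix_mulVec_insertDigit_of_ne (t : ℕ) {u : Fin (numGroups n s)} (hu : u ≠ a)
    (b : Fin (s + 1)) (x : Fin s → F) (f : SymbolIndex n s → F) (e : Fin s) (i : RestIndex a)
    (p : Fin t) : (blockMatrix t u b x).mulVec f (insertDigit a e i, p) =
      (blockMatrix t (⟨u, hu⟩ : {u // u ≠ a}) b x).mulVec (fun y => f (insertDigit a e y))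
        (i, p) := by
  simp only [blockMatrix_mulVec, update_insertDigit_of_ne _ _ _ hu, insertDigit_of_ne _ _ hu]

theorem blockMatrix_mulVec_insertDigit_self (t : ℕ) (b : Fin (s + 1)) (x : Fin s → F)
    (f : SymbolIndex n s → F) (e : Fin s) (i : RestIndex a) (p : Fin t) :
    (blockMatrix t a b x).mulVec f (insertDigit a e i, p) =
      ∑ e', foldMatrix F b e e' * (x e' ^ (p : ℕ) * f (insertDigit a e' i)) := by
  simp only [blockMatrix_mulVec, update_insertDigit_self, insertDigit_self]

theorem blockMatrix_mulVec_insertDigit_of_castSucc_ne (t : ℕ) {b : Fin (s + 1)} {e : Fin s}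
    (he : e.castSucc ≠ b) (x : Fin s → F) (f : SymbolIndex n s → F) (i : RestIndex a)
    (p : Fin t) : (blockMatrix t a b x).mulVec f (insertDigit a e i, p) =
      x e ^ (p : ℕ) * f (insertDigit a e i) := by
  rw [blockMatrix_mulVec_insertDigit_self, Finset.sum_eq_single e]
  · rw [foldMatrix_of_castSucc_ne he, if_pos rfl, one_mul]
  · intro e' _ hne
    rw [foldMatrix_of_castSucc_ne he, if_neg hne.symm, zero_mul]
  · exact fun h => absurd (Finset.mem_univ e) h

theorem sum_foldMatrix_castSucc (b e' : Fin s) :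
    ∑ e, foldMatrix F b.castSucc e e' = if e' = b then 1 else 0 := by
  by_cases h : e' = b
  · subst h
    rw [Finset.sum_eq_single e'] <;> simp +contextual [foldMatrix]
  · rw [if_neg h, Fintype.sum_eq_add e' b h]
    · simp [foldMatrix, Ne.symm h]
    · rintro x ⟨h1, h2⟩
      simp [foldMatrix, h1, h2]

theorem sum_blockMatrix_castSucc_mulVec_insertDigit (t : ℕ) (b : Fin s) (x : Fin s → F)
    (f : SymbolIndex n s → F) (i : RestIndex a) (p : Fin t) :
    ∑ e, (blockMatrix t a b.castSucc x).mulVec f (insertDigit a e i, p) =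
      x b ^ (p : ℕ) * f (insertDigit a b i) := by
  simp only [blockMatrix_mulVec_insertDigit_self]
  rw [Finset.sum_comm]
  simp only [← Finset.sum_mul, sum_foldMatrix_castSucc, ite_mul, one_mul, zero_mul,
    Finset.sum_ite_eq', Finset.mem_univ, if_true]

theorem downloadFirst_mulVec (b : Fin s) (j : Fin n) (f : SymbolIndex n s → F) :
    (downloadFirst F a b j).mulVec f = fun x => f (insertDigit a b x) := by
  funext x
  simp [Matrix.mulVec, dotProduct, downloadFirst]

theorem downloadLast_of_eq {j : Fin n} (hj : nodeGroup s j = a) {b : Fin s}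
    (hb : b.castSucc = nodePos s j) : downloadLast F a j = downloadFirst F a b j := by
  funext x i
  have digit_eq : (∃ e : Fin s, (nodeGroup s j = a → e.castSucc = nodePos s j) ∧
      i = insertDigit a e x) ↔ i = insertDigit a b x := by
    refine ⟨fun ⟨e, he, hi⟩ => ?_, fun hi => ⟨b, fun _ => hb, hi⟩⟩
    rwa [← Fin.castSucc_injective _ ((he hj).trans hb.symm)]
  simp only [downloadLast, downloadFirst, digit_eq]

theorem downloadLast_of_ne {j : Fin n} (hj : nodeGroup s j ≠ a) (x : RestIndex a)
    (i : SymbolIndex n s) :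
    downloadLast F a j x i = if ∃ e, i = insertDigit a e x then 1 else 0 := by
  simp only [downloadLast, hj, false_imp_iff, true_and]

theorem downloadLast_mulVec_of_ne {j : Fin n} (hj : nodeGroup s j ≠ a)
    (f : SymbolIndex n s → F) :
    (downloadLast F a j).mulVec f = ∑ e, fun x => f (insertDigit a e x) := by
  funext x
  rw [Finset.sum_apply]
  symm
  refine Finset.sum_of_injOn (fun e => insertDigit a e x)
    (fun e _ e' _ h => (insertDigit_inj.1 h).1) (fun _ _ => Finset.mem_coe.2 (Finset.mem_univ _))
    (fun i _ hi => ?_) fun e _ => ?_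
  · have hne : ¬∃ e, i = insertDigit a e x := by
      rintro ⟨e, rfl⟩
      exact hi ⟨e, Finset.mem_coe.2 (Finset.mem_univ e), rfl⟩
    simp only [downloadLast_of_ne hj, if_neg hne, zero_mul]
  · have hex : ∃ e', insertDigit a e x = insertDigit a e' x := ⟨e, rfl⟩
    simp only [downloadLast_of_ne hj, if_pos hex, one_mul]

theorem parityCheck_sum_eq_reducedCheckFirst (lam : Scalars F n s) (r : ℕ) (h : Fin n) (b : Fin s)
    (hb : nodePos s h = b.castSucc) (c : Fin n → SymbolIndex n s → F)
    (x : RestIndex (nodeGroup s h)) (p : Fin r) :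
    (∑ j, (parityCheck lam r j).mulVec (c j)) (insertDigit (nodeGroup s h) b x, p) =
      (∑ z, (reducedCheckFirst lam r h b z).mulVec
        (reducedWord h (downloadFirst F (nodeGroup s h) b) c z)) (x, p) := by
  rw [Finset.sum_apply, Finset.sum_apply, Fintype.sum_sum_type,
    Fintype.sum_eq_add_sum_subtype_ne _ h, add_comm]
  congr 1
  · refine Finset.sum_congr rfl fun z _ => ?_
    by_cases hz : nodeGroup s z.1 = nodeGroup s h
    · have hne : b.castSucc ≠ nodePos s z.1 := fun h' => z.2 (node_ext hz (h'.symm.trans hb.symm))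
      simp only [reducedCheckFirst, reducedWord, dif_neg (not_not.2 hz), downloadFirst_mulVec,
        diagMatrix_mulVec]
      rw [parityCheck, hz, blockMatrix_mulVec_insertDigit_of_castSucc_ne r hne]
    · simp only [reducedCheckFirst, reducedWord, dif_pos hz, downloadFirst_mulVec]
      exact blockMatrix_mulVec_insertDigit_of_ne r hz _ _ _ _ _ _
  · rw [parityCheck, blockMatrix_mulVec_insertDigit_self, hb]
    refine Finset.sum_congr rfl fun e _ => ?_
    by_cases he : e = b
    · simp [reducedCheckFirst, reducedWord, diagMatrix_mulVec, foldMatrix, he]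
    · simp [reducedCheckFirst, reducedWord, diagMatrix_mulVec, foldMatrix, he, Ne.symm he,
        Matrix.neg_mulVec]

theorem parityCheck_sum_eq_reducedCheckLast (lam : Scalars F n s) (r : ℕ) (h : Fin n)
    (hh : nodePos s h = Fin.last s) (c : Fin n → SymbolIndex n s → F)
    (x : RestIndex (nodeGroup s h)) (p : Fin r) :
    ∑ e : Fin s, (∑ j, (parityCheck lam r j).mulVec (c j)) (insertDigit (nodeGroup s h) e x, p) =
      (∑ z, (reducedCheckLast lam r h z).mulVec
        (reducedWord h (downloadLast F (nodeGroup s h)) c z)) (x, p) := by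
  simp only [Finset.sum_apply]
  rw [Finset.sum_comm, Fintype.sum_sum_type, Fintype.sum_eq_add_sum_subtype_ne _ h, add_comm]
  congr 1
  · refine Finset.sum_congr rfl fun z _ => ?_
    by_cases hz : nodeGroup s z.1 = nodeGroup s h
    · have hne : nodePos s z.1 ≠ Fin.last s := fun h' => z.2 (node_ext hz (h'.trans hh.symm))
      have hlt : (nodePos s z.1 : ℕ) < s := Fin.val_lt_last hne
      obtain ⟨b, hb⟩ : ∃ b : Fin s, b.castSucc = nodePos s z.1 := Fin.exists_castSucc_eq.2 hne
      have digit_eq : (⟨nodePos s z.1, hlt⟩ : Fin s) = b :=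
        Fin.castSucc_injective _ hb.symm
      simp only [reducedCheckLast, reducedWord, dif_neg (not_not.2 hz), dif_pos hlt,
        downloadLast_of_eq hz hb, downloadFirst_mulVec, diagMatrix_mulVec]
      rw [digit_eq, parityCheck, hz, ← hb]
      exact sum_blockMatrix_castSucc_mulVec_insertDigit ..
    · simp only [reducedCheckLast, reducedWord, dif_pos hz, downloadLast_mulVec_of_ne hz,
        Matrix.mulVec_sum, Finset.sum_apply]
      exact Finset.sum_congr rfl fun e _ => blockMatrix_mulVec_insertDigit_of_ne r hz _ _ _ _ _ _
  · refine Finset.sum_congr rfl fun e _ => ?_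
    have hne : e.castSucc ≠ Fin.last s := (Fin.castSucc_lt_last e).ne
    rw [parityCheck, hh, blockMatrix_mulVec_insertDigit_of_castSucc_ne r hne, reducedCheckLast,
      diagMatrix_mulVec]
    rfl

end ReducedParityChecks

section Repair

theorem exists_comp_eq_of_ker_le_ker {K U V W : Type*} [DivisionRing K] [AddCommGroup U]
    [Module K U] [AddCommGroup V] [Module K V] [AddCommGroup W] [Module K W] {φ : V →ₗ[K] W}
    {ψ : V →ₗ[K] U} (h : LinearMap.ker φ ≤ LinearMap.ker ψ) : ∃ g : W →ₗ[K] U, g ∘ₗ φ = ψ := by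
  obtain ⟨retract, hretract⟩ := LinearMap.exists_leftInverse_of_injective
    ((LinearMap.ker φ).liftQ φ le_rfl) (Submodule.ker_liftQ_eq_bot' _ _ rfl)
  refine ⟨(LinearMap.ker φ).liftQ ψ h ∘ₗ retract, LinearMap.ext fun v => ?_⟩
  exact congrArg ((LinearMap.ker φ).liftQ ψ h)
    (LinearMap.congr_fun hretract ((LinearMap.ker φ).mkQ v))

variable {F ν ι : Type*} [Field F] [Fintype ι] {C : Submodule F (ν → ι → F)} {h : ν}
  {𝓗 : Finset ν} {β : ν → Type*} {D : ∀ j, Matrix (β j) ι F}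

theorem repairs_of_forall_eq_zero (H : ∀ c ∈ C, (∀ j ∈ 𝓗, (D j).mulVec (c j) = 0) → c h = 0) :
    Repairs C h 𝓗 D := by
  let download : C →ₗ[F] (∀ j : 𝓗, β j → F) :=
    (LinearMap.pi fun j : 𝓗 => (D j).mulVecLin ∘ₗ LinearMap.proj j.1) ∘ₗ C.subtype
  let content : C →ₗ[F] (ι → F) := LinearMap.proj h ∘ₗ C.subtype
  have ker_le : LinearMap.ker download ≤ LinearMap.ker content := fun c hc =>
    H c c.2 fun j hj => congrFun (LinearMap.mem_ker.1 hc) ⟨j, hj⟩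
  obtain ⟨g, hg⟩ := exists_comp_eq_of_ker_le_ker ker_le
  exact ⟨g, fun c hc => LinearMap.congr_fun hg ⟨c, hc⟩⟩

theorem Repairs.reindex {β' : ν → Type*} (hD : Repairs C h 𝓗 D) (e : ∀ j, β j ≃ β' j) :
    Repairs C h 𝓗 fun j => (D j).submatrix (e j).symm id := by
  obtain ⟨g, hg⟩ := hD
  refine ⟨g ∘ₗ LinearMap.pi fun j => LinearMap.funLeft F F (e j) ∘ₗ LinearMap.proj j,
    fun c hc => (congrArg g (funext fun j => funext fun x => ?_)).trans (hg c hc)⟩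
  simp [Matrix.mulVec]

end Repair

section RepairSchemes

variable {n s : ℕ}

theorem mul_card_restIndex_eq_cutSetBound (hs : 0 < s) {k d : ℕ} (hd : d + 1 = k + s)
    (a : Fin (numGroups n s)) :
    ((d * Fintype.card (RestIndex a) : ℕ) : ℚ) = cutSetBound k d (s ^ (n ⌈/⌉ (s + 1))) := by
  have hsq : (s : ℚ) ≠ 0 := Nat.cast_ne_zero.2 hs.ne'
  have sub_add_eq : (d : ℚ) - k + 1 = s := by
    have hdq : (d : ℚ) + 1 = k + s := by exact_mod_cast hd
    linarith
  rw [cutSetBound, sub_add_eq, ← card_restIndex_mul a]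
  push_cast
  field_simp

theorem repairBandwidth_eq_cutSetBound {F : Type*} (hs : 0 < s) {k : ℕ} {𝓗 : Finset (Fin n)}
    (hd : 𝓗.card + 1 = k + s) {a : Fin (numGroups n s)}
    (D : Fin n → Matrix (RestIndex a) (SymbolIndex n s) F) :
    (repairBandwidth 𝓗 D : ℚ) = cutSetBound k 𝓗.card (s ^ (n ⌈/⌉ (s + 1))) := by
  rw [repairBandwidth, Finset.sum_const, smul_eq_mul, mul_card_restIndex_eq_cutSetBound hs hd]

variable {F : Type*} [Field F]

theorem repairs_of_reducedWord_mem {C : Submodule F (Fin n → SymbolIndex n s → F)} {h : Fin n}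
    {D : Fin n → Matrix (RestIndex (nodeGroup s h)) (SymbolIndex n s) F}
    {C' : Submodule F (ReducedNode s h → RestIndex (nodeGroup s h) → F)} {𝓗 : Finset (Fin n)}
    (hC' : IsMDSArrayCode C' 𝓗.card) (hmem : ∀ c ∈ C, reducedWord h D c ∈ C') (hh : h ∉ 𝓗) :
    Repairs C h 𝓗 D := by
  refine repairs_of_forall_eq_zero fun c hc h0 => ?_
  let helper : 𝓗 ↪ ReducedNode s h := ⟨fun j => Sum.inl ⟨j.1, fun h' => hh (h' ▸ j.2)⟩,
    fun j j' hjj => Subtype.ext (Subtype.mk.inj (Sum.inl.inj hjj))⟩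
  have reducedWord_eq_zero : reducedWord h D c = 0 := by
    refine hC'.2 (𝓗.attach.map helper) (by rw [Finset.card_map, Finset.card_attach]) _ (hmem c hc)
      0 C'.zero_mem ?_
    simp only [Finset.forall_mem_map]
    exact fun j _ => h0 j j.2
  funext i
  have symbol_eq_zero :=
    congrFun (congrFun reducedWord_eq_zero (Sum.inr (i (nodeGroup s h)))) fun u => i u
  simp only [reducedWord, insertDigit_restrict] at symbol_eq_zero
  exact symbol_eq_zero

theorem accessedSymbols_downloadFirst (a : Fin (numGroups n s)) (b : Fin s) (j : Fin n) :
    accessedSymbols (downloadFirst F a b j) = Set.range (insertDigit a b) := by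
  ext i
  simp [accessedSymbols, downloadFirst, eq_comm]

theorem accessedSymbols_downloadLast_of_ne {a : Fin (numGroups n s)} {j : Fin n}
    (hj : nodeGroup s j ≠ a) : accessedSymbols (downloadLast F a j) = Set.univ := by
  refine Set.eq_univ_of_forall fun i => ⟨fun u => i u, ?_⟩
  rw [downloadLast_of_ne hj, if_pos ⟨i a, (insertDigit_restrict i).symm⟩]
  exact one_ne_zero

theorem repairAccess_downloadFirst_eq_cutSetBound (hs : 0 < s) {k : ℕ} {𝓗 : Finset (Fin n)}
    (hd : 𝓗.card + 1 = k + s) (a : Fin (numGroups n s)) (b : Fin s) :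
    (repairAccess 𝓗 (downloadFirst F a b) : ℚ) = cutSetBound k 𝓗.card (s ^ (n ⌈/⌉ (s + 1))) := by
  simp only [repairAccess, accessedSymbols_downloadFirst, ncard_range_insertDigit,
    Finset.sum_const, smul_eq_mul, mul_card_restIndex_eq_cutSetBound hs hd]

theorem cutSetBound_lt_repairAccess_downloadLast (hs : 2 ≤ s) {k : ℕ} {𝓗 : Finset (Fin n)}
    (hd : 𝓗.card + 1 = k + s) {h : Fin n} (hl : nodePos s h = Fin.last s) (hh : h ∉ 𝓗)
    (hout : ∃ j ∈ 𝓗, nodeGroup s j ≠ nodeGroup s h) :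
    cutSetBound k 𝓗.card (s ^ (n ⌈/⌉ (s + 1))) <
      (repairAccess 𝓗 (downloadLast F (nodeGroup s h)) : ℚ) := by
  have : NeZero s := ⟨by omega⟩
  have lt_of_ne (j : Fin n) (hj : nodeGroup s j ≠ nodeGroup s h) :
      Fintype.card (RestIndex (nodeGroup s h)) <
        (accessedSymbols (downloadLast F (nodeGroup s h) j)).ncard := by
    rw [accessedSymbols_downloadLast_of_ne hj, Set.ncard_univ, Nat.card_eq_fintype_card,
      card_symbolIndex, ← card_restIndex_mul (nodeGroup s h)]
    exact lt_mul_of_one_lt_right Fintype.card_pos hs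
  rw [← mul_card_restIndex_eq_cutSetBound (by omega) hd (nodeGroup s h), Nat.cast_lt,
    repairAccess, ← smul_eq_mul, ← Finset.sum_const]
  obtain ⟨j₀, hj₀, hne⟩ := hout
  refine Finset.sum_lt_sum (fun j hj => ?_) ⟨j₀, hj₀, lt_of_ne j₀ hne⟩
  by_cases hg : nodeGroup s j = nodeGroup s h
  · obtain ⟨b, hb⟩ : ∃ b : Fin s, b.castSucc = nodePos s j := Fin.exists_castSucc_eq.2 fun hlast =>
      hh (node_ext hg (hlast.trans hl.symm) ▸ hj)
    rw [downloadLast_of_eq hg hb, accessedSymbols_downloadFirst, ncard_range_insertDigit]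
  · exact (lt_of_ne j hg).le

variable {lam : Scalars F n s} {k : ℕ}

theorem Admissible.repairs_downloadFirst (hlam : Admissible lam) (hk : k ≤ n) {h : Fin n}
    {b : Fin s} (hb : nodePos s h = b.castSucc) {𝓗 : Finset (Fin n)} (hh : h ∉ 𝓗)
    (hd : 𝓗.card + 1 = k + s) :
    Repairs (secondCode lam (n - k)) h 𝓗 (downloadFirst F (nodeGroup s h) b) := by
  have mds := hlam.isMDSArrayCode_reducedCheckFirst hk h b hb
  rw [← hd, Nat.add_sub_cancel] at mds
  refine repairs_of_reducedWord_mem mds (fun c hc => funext fun ip => ?_) hh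
  have parity : ∑ j, (parityCheck lam (n - k) j).mulVec (c j) = 0 := hc
  rw [← parityCheck_sum_eq_reducedCheckFirst lam (n - k) h b hb c ip.1 ip.2, parity]
  rfl

theorem Admissible.repairs_downloadLast (hlam : Admissible lam) (hs : 0 < s) (hk : k ≤ n)
    {h : Fin n} (hl : nodePos s h = Fin.last s) {𝓗 : Finset (Fin n)} (hh : h ∉ 𝓗)
    (hd : 𝓗.card + 1 = k + s) :
    Repairs (secondCode lam (n - k)) h 𝓗 (downloadLast F (nodeGroup s h)) := by
  have mds := hlam.isMDSArrayCode_reducedCheckLast hs hk h hl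
  rw [← hd, Nat.add_sub_cancel] at mds
  refine repairs_of_reducedWord_mem mds (fun c hc => funext fun ip => ?_) hh
  have parity : ∑ j, (parityCheck lam (n - k) j).mulVec (c j) = 0 := hc
  rw [← parityCheck_sum_eq_reducedCheckLast lam (n - k) h hl c ip.1 ip.2, parity]
  exact Finset.sum_const_zero

theorem Admissible.isMSRCode_secondCode (hlam : Admissible lam) (hs : 0 < s) (hk : k ≤ n) {d : ℕ}
    (hd : d + 1 = k + s) : IsMSRCode (secondCode lam (n - k)) k d (s ^ (n ⌈/⌉ (s + 1))) := by
  refine ⟨card_symbolIndex, hlam.isMDSArrayCode_secondCode hk, fun h 𝓗 hh h𝓗 => ?_⟩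
  subst h𝓗
  obtain ⟨D, hD⟩ : ∃ D : Fin n → Matrix (RestIndex (nodeGroup s h)) (SymbolIndex n s) F,
      Repairs (secondCode lam (n - k)) h 𝓗 D := by
    by_cases hl : nodePos s h = Fin.last s
    · exact ⟨_, hlam.repairs_downloadLast hs hk hl hh hd⟩
    · obtain ⟨b, hb⟩ := Fin.exists_castSucc_eq.2 hl
      exact ⟨_, hlam.repairs_downloadFirst hk hb.symm hh hd⟩
  refine ⟨fun _ => Fintype.card (RestIndex (nodeGroup s h)), _,
    hD.reindex fun _ => Fintype.equivFin _, ?_⟩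
  rw [← repairBandwidth_eq_cutSetBound hs hd D]
  simp only [repairBandwidth, Fintype.card_fin]

end RepairSchemes

section LocalDeterminants

variable {R F : Type*} [CommRing R] [Field F] {s : ℕ}

/-- The determinant of the local constraint on `B`, in the coordinates of a single digit. -/
def localDet (x : Fin (s + 1) → Fin s → R) (B : Finset (Fin (s + 1))) : R :=
  (blockColumns (fun b => powerCheck B.card (foldMatrix R b) (Matrix.diagonal (x b))) B).det

theorem localDet_ne_zero_iff {x : Fin (s + 1) → Fin s → F} {B : Finset (Fin (s + 1))} :
    localDet x B ≠ 0 ↔ LocallyIndependent x B :=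
  det_blockColumns_ne_zero_iff.trans jointlyInjectiveOn_powerCheck_iff

theorem powerCheck_diagonal_apply {ι : Type*} [Fintype ι] [DecidableEq ι] (t : ℕ)
    (M : Matrix ι ι R) (y : ι → R) (i : ι) (p : Fin t) (j : ι) :
    powerCheck t M (Matrix.diagonal y) (i, p) j = M i j * y j ^ (p : ℕ) := by
  rw [powerCheck, Matrix.diagonal_pow, Matrix.mul_diagonal, Pi.pow_apply]

theorem map_localDet {R' : Type*} [CommRing R'] (f : R →+* R') (x : Fin (s + 1) → Fin s → R)
    (B : Finset (Fin (s + 1))) : f (localDet x B) = localDet (fun b e => f (x b e)) B := by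
  rw [localDet, f.map_det, localDet]
  congr 1
  funext ⟨i, p⟩ jq
  simp only [RingHom.mapMatrix_apply, Matrix.map_apply, blockColumns, powerCheck_diagonal_apply,
    map_mul, map_pow, foldMatrix, apply_ite f, map_one, map_neg, map_zero]

theorem eq_zero_of_foldMatrix_mulVec_eq_zero {b : Fin (s + 1)} {v : Fin s → F}
    (h : (foldMatrix F b).mulVec v = 0) : v = 0 := by
  have apply_eq_zero_of_ne (i : Fin s) (hi : i.castSucc ≠ b) : v i = 0 := by
    simpa [Matrix.mulVec, dotProduct, foldMatrix_of_castSucc_ne hi] using congrFun h i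
  funext i
  by_cases hi : i.castSucc = b
  · have summand_eq_zero (e : Fin s) (he : e ≠ i) : foldMatrix F b i e * v e = 0 := by
      rw [apply_eq_zero_of_ne e (hi ▸ (Fin.castSucc_injective s).ne he), mul_zero]
    have hsum := congrFun h i
    rw [Matrix.mulVec, dotProduct, Fintype.sum_eq_single i summand_eq_zero] at hsum
    simpa [foldMatrix] using hsum
  · exact apply_eq_zero_of_ne i hi

theorem powerIndependentOn_diagonal_const {α ι : Type*} [Fintype ι] [DecidableEq ι]
    {M : α → Matrix ι ι F} {x : α → F} {B : Finset α} (hx : Set.InjOn x B)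
    (hM : ∀ b ∈ B, ∀ v, (M b).mulVec v = 0 → v = 0) :
    PowerIndependentOn M (fun b => Matrix.diagonal fun _ => x b) B := by
  intro c hc b hb
  refine hM b hb _ (funext fun i => ?_)
  have mulVec_apply (z : α) (p : ℕ) :
      (M z * (Matrix.diagonal fun _ => x z) ^ p).mulVec (c z) i =
        (M z).mulVec (c z) i * x z ^ p := by
    rw [Matrix.diagonal_pow, ← Matrix.mulVec_mulVec]
    have smul_eq : (Matrix.diagonal ((fun _ : ι => x z) ^ p)).mulVec (c z) = x z ^ p • c z :=
      funext fun j => Matrix.mulVec_diagonal _ _ j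
    rw [smul_eq, Matrix.mulVec_smul, Pi.smul_apply, smul_eq_mul, mul_comm]
  have vandermonde_eq_zero := Matrix.eq_zero_of_forall_pow_sum_mul_pow_eq_zero
    (f := fun q => x (B.equivFin.symm q))
    (v := fun q => (M (B.equivFin.symm q)).mulVec (c (B.equivFin.symm q)) i)
    (hx.injective.comp B.equivFin.symm.injective) fun p => by
      have := congrFun (hc p p.2) i
      simp only [powerSum, Finset.sum_apply, mulVec_apply] at this
      rwa [← B.sum_coe_sort, ← B.equivFin.symm.sum_comp] at this
  simpa using congrFun vandermonde_eq_zero (B.equivFin ⟨b, hb⟩)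

theorem locallyIndependent_of_injective {x : Fin (s + 1) → F} (hx : Function.Injective x)
    (B : Finset (Fin (s + 1))) : LocallyIndependent (fun b _ => x b) B :=
  powerIndependentOn_diagonal_const hx.injOn fun _ _ _ => eq_zero_of_foldMatrix_mulVec_eq_zero

end LocalDeterminants

section Polynomials

open MvPolynomial

theorem degreeOf_det_le {R σ m : Type*} [CommRing R] [Fintype m] [DecidableEq m]
    {A : Matrix m m (MvPolynomial σ R)} {x : σ} {w : m → ℕ}
    (h : ∀ i j, (A i j).degreeOf x ≤ w i) : A.det.degreeOf x ≤ ∑ i, w i := by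
  rw [Matrix.det_apply]
  refine (degreeOf_sum_le _ _ _).trans (Finset.sup_le fun π _ => ?_)
  have degreeOf_prod : (∏ i, A (π i) i).degreeOf x ≤ ∑ i, w i := by
    rw [← Equiv.sum_comp π w]
    exact (degreeOf_prod_le _ _ _).trans (Finset.sum_le_sum fun i _ => h (π i) i)
  rcases Int.units_eq_one_or (Equiv.Perm.sign π) with hsign | hsign
  · rwa [hsign, one_smul]
  · rwa [hsign, Units.neg_smul, one_smul, degreeOf_neg]

theorem exists_eval_ne_zero_of_degreeOf_lt_card {F σ : Type*} [Field F] [Fintype F] [Finite σ]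
    {P : MvPolynomial σ F} (hP : P ≠ 0) (hdeg : ∀ x, P.degreeOf x < Fintype.card F) :
    ∃ v : σ → F, eval v P ≠ 0 := by
  by_contra! h
  exact hP (eq_zero_of_eval_zero_at_prod_finset P (fun _ => Finset.univ) hdeg fun v _ => h v)

variable {F : Type*} [Field F] {s : ℕ}

theorem localDet_X_ne_zero (F : Type*) [Field F] {G : Type*} (a : G) (B : Finset (Fin (s + 1))) :
    localDet (fun b e => (X (a, b, e) : MvPolynomial (G × Fin (s + 1) × Fin s) F)) B ≠ 0 := by
  let x : Fin (s + 1) ↪ AlgebraicClosure F :=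
    Fin.valEmbedding.trans (Infinite.natEmbedding (AlgebraicClosure F))
  let φ : MvPolynomial (G × Fin (s + 1) × Fin s) F →+* AlgebraicClosure F :=
    eval₂Hom (algebraMap F _) fun y => x y.2.1
  refine ne_zero_of_map (f := φ) ?_
  simp only [map_localDet, φ, coe_eval₂Hom, eval₂_X]
  exact localDet_ne_zero_iff.2 (locallyIndependent_of_injective x.injective B)

theorem degreeOf_localDet_X_le {G : Type*} [DecidableEq G] (a : G) (B : Finset (Fin (s + 1)))
    (y : G × Fin (s + 1) × Fin s) :
    (localDet (fun b e => (X (a, b, e) : MvPolynomial (G × Fin (s + 1) × Fin s) F)) B).degreeOf y ≤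
      if y.1 = a then s * (B.card * (B.card - 1) / 2) else 0 := by
  let w : Fin s × Fin B.card → ℕ := fun ip => if y.1 = a then ip.2 else 0
  refine (degreeOf_det_le (w := w) fun ip jq => ?_).trans_eq ?_
  · rw [blockColumns, powerCheck_diagonal_apply]
    refine (degreeOf_mul_le _ _ _).trans ?_
    have degreeOf_foldMatrix (b : Fin (s + 1)) (i e : Fin s) : degreeOf y
        (foldMatrix (MvPolynomial (G × Fin (s + 1) × Fin s) F) b i e) = 0 := by
      simp only [foldMatrix, apply_ite (degreeOf y), degreeOf_one, degreeOf_neg, degreeOf_zero,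
        ite_self]
    rw [degreeOf_foldMatrix, zero_add]
    refine (degreeOf_pow_le _ _ _).trans ?_
    rw [degreeOf_X]
    split_ifs <;> simp_all [w]
  · split_ifs with hy
    · simp only [w, if_pos hy, Fintype.sum_prod_type, Finset.sum_const, Finset.card_univ,
        Fintype.card_fin, smul_eq_mul]
      rw [Fin.sum_univ_eq_sum_range (fun p => p), Finset.sum_range_id]
    · simp only [w, if_neg hy, Finset.sum_const_zero]

theorem degreeOf_prod_localDet_X_le {G : Type*} [Fintype G] (y : G × Fin (s + 1) × Fin s) :
    degreeOf y (∏ a, ∏ B, localDet (fun b e => X (R := F) (a, b, e)) B) ≤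
      ∑ B : Finset (Fin (s + 1)), s * (B.card * (B.card - 1) / 2) := by
  classical
  calc degreeOf y (∏ a, ∏ B, localDet (fun b e => X (R := F) (a, b, e)) B)
    _ ≤ ∑ a, ∑ B, degreeOf y (localDet (fun b e => X (R := F) (a, b, e)) B) :=
      (degreeOf_prod_le _ _ _).trans (Finset.sum_le_sum fun a _ => degreeOf_prod_le _ _ _)
    _ ≤ ∑ a, ∑ B : Finset (Fin (s + 1)),
          if y.1 = a then s * (B.card * (B.card - 1) / 2) else 0 :=
      Finset.sum_le_sum fun a _ => Finset.sum_le_sum fun B _ => degreeOf_localDet_X_le a B y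
    _ = ∑ B : Finset (Fin (s + 1)), s * (B.card * (B.card - 1) / 2) := by
      rw [Finset.sum_comm]
      exact Finset.sum_congr rfl fun B _ => Fintype.sum_ite_eq y.1 _

/-- The Vandermonde determinant of the variables: it vanishes at the points with two equal
coordinates. -/
noncomputable def vandermondeDet (R σ : Type*) [CommRing R] [Fintype σ] : MvPolynomial σ R :=
  (Matrix.vandermonde fun i => X ((Fintype.equivFin σ).symm i)).det

theorem vandermondeDet_ne_zero (R σ : Type*) [CommRing R] [IsDomain R] [Fintype σ] :
    vandermondeDet R σ ≠ 0 :=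
  Matrix.det_vandermonde_ne_zero_iff.2
    (X_injective.comp (Fintype.equivFin σ).symm.injective)

theorem injective_of_eval_vandermondeDet_ne_zero {R σ : Type*} [CommRing R] [IsDomain R] [Fintype σ]
    {v : σ → R} (h : eval v (vandermondeDet R σ) ≠ 0) : Function.Injective v := by
  have eval_vandermonde : (eval v).mapMatrix
      (Matrix.vandermonde fun i => X ((Fintype.equivFin σ).symm i)) =
        Matrix.vandermonde (v ∘ (Fintype.equivFin σ).symm) := by
    ext i j
    simp [Matrix.vandermonde]
  rw [vandermondeDet, RingHom.map_det, eval_vandermonde, Matrix.det_vandermonde_ne_zero_iff] at h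
  exact (Equiv.injective_comp _ _).1 h

theorem degreeOf_vandermondeDet_le (R : Type*) {σ : Type*} [CommRing R] [Nontrivial R] [Fintype σ]
    (x : σ) :
    (vandermondeDet R σ).degreeOf x ≤ Fintype.card σ - 1 := by
  classical
  let e := Fintype.equivFin σ
  refine (degreeOf_det_le (w := fun i => if e x = i then Fintype.card σ - 1 else 0)
    fun i j => ?_).trans_eq (by simp)
  rw [Matrix.vandermonde_apply]
  refine (degreeOf_pow_le _ _ _).trans ?_
  split_ifs with hi
  · rw [← hi, Equiv.symm_apply_apply, degreeOf_X, if_pos rfl, mul_one]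
    exact Nat.le_sub_one_of_lt j.2
  · rw [degreeOf_X, if_neg fun h => hi (by rw [h, Equiv.apply_symm_apply]), mul_zero]

theorem exists_injective_locallyIndependent [Fintype F] (G : Type*) [Fintype G]
    (hF : Fintype.card G * ((s + 1) * s) +
      ∑ B : Finset (Fin (s + 1)), s * (B.card * (B.card - 1) / 2) ≤ Fintype.card F) :
    ∃ lam : G × Fin (s + 1) × Fin s → F, Function.Injective lam ∧
      ∀ a B, LocallyIndependent (fun b e => lam (a, b, e)) B := by
  classical
  let P : MvPolynomial (G × Fin (s + 1) × Fin s) F :=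
    vandermondeDet F _ * ∏ a, ∏ B, localDet (fun b e => X (a, b, e)) B
  have P_ne_zero : P ≠ 0 := mul_ne_zero (vandermondeDet_ne_zero F _) <|
    Finset.prod_ne_zero_iff.2 fun a _ => Finset.prod_ne_zero_iff.2 fun B _ =>
      localDet_X_ne_zero F a B
  have degreeOf_P_lt (y) : P.degreeOf y < Fintype.card F := by
    have card_pos : 0 < Fintype.card (G × Fin (s + 1) × Fin s) := Fintype.card_pos_iff.2 ⟨y⟩
    calc P.degreeOf y
      _ ≤ (Fintype.card (G × Fin (s + 1) × Fin s) - 1) + _ :=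
        (degreeOf_mul_le _ _ _).trans <|
          add_le_add (degreeOf_vandermondeDet_le F y) (degreeOf_prod_localDet_X_le y)
      _ < Fintype.card (G × Fin (s + 1) × Fin s) + _ :=
        Nat.add_lt_add_right (Nat.sub_one_lt card_pos.ne') _
      _ ≤ Fintype.card F := by simpa only [Fintype.card_prod, Fintype.card_fin] using hF
  obtain ⟨lam, hlam⟩ := exists_eval_ne_zero_of_degreeOf_lt_card P_ne_zero degreeOf_P_lt
  simp only [P, map_mul, map_prod, map_localDet, eval_X] at hlam
  refine ⟨lam, injective_of_eval_vandermondeDet_ne_zero (left_ne_zero_of_mul hlam), fun a B => ?_⟩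
  exact localDet_ne_zero_iff.1 <| Finset.prod_ne_zero_iff.1
    (Finset.prod_ne_zero_iff.1 (right_ne_zero_of_mul hlam) a (Finset.mem_univ a)) B
      (Finset.mem_univ B)

end Polynomials

section FieldSize

theorem sum_finset_card_eq_sum_choose (s : ℕ) :
    ∑ B : Finset (Fin (s + 1)), s * (B.card * (B.card - 1) / 2) =
      ∑ t ∈ Finset.Icc 1 (s + 1), (s + 1).choose t * (s * (t * (t - 1) / 2)) := by
  rw [← Finset.powerset_univ, Finset.sum_powerset_apply_card fun t => s * (t * (t - 1) / 2),
    Finset.card_univ, Fintype.card_fin, Finset.range_eq_Ico,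
    Finset.sum_eq_sum_Ico_succ_bot (Nat.succ_pos _)]
  simp only [smul_eq_mul, zero_mul, Nat.zero_div, mul_zero, zero_add]
  rfl

theorem exists_admissible {F : Type*} [Field F] [Fintype F] {n s : ℕ}
    (hF : fieldSizeBound n s ≤ Fintype.card F) : ∃ lam : Scalars F n s, Admissible lam := by
  have card_bound : Fintype.card (Fin (numGroups n s)) * ((s + 1) * s) +
      ∑ B : Finset (Fin (s + 1)), s * (B.card * (B.card - 1) / 2) ≤ Fintype.card F := by
    rwa [Fintype.card_fin, sum_finset_card_eq_sum_choose, ← mul_assoc,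
      mul_comm (numGroups n s) (s + 1)]
  obtain ⟨lam, hinj, hloc⟩ := exists_injective_locallyIndependent _ card_bound
  exact ⟨lam, hinj, fun a B => (det_localMatrix_ne_zero_iff lam a B).2 (hloc a B)⟩

theorem fieldSizeBound_le (s : ℕ) {n : ℕ} (hn : 1 ≤ n) :
    fieldSizeBound n s ≤ ((s + 1) * s +
      ∑ t ∈ Finset.Icc 1 (s + 1), (s + 1).choose t * (s * (t * (t - 1) / 2))) * n := by
  have numGroups_le : numGroups n s ≤ n :=
    (ceilDiv_le_iff_le_mul s.succ_pos).2 (Nat.le_mul_of_pos_left n s.succ_pos)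
  rw [fieldSizeBound, add_mul ((s + 1) * s)]
  refine add_le_add ?_ (Nat.le_mul_of_pos_right _ hn)
  calc (s + 1) * numGroups n s * s ≤ (s + 1) * n * s := by gcongr
    _ = (s + 1) * s * n := by ring

theorem exists_prime_fieldSizeBound_le (s : ℕ) :
    ∃ K : ℕ, ∀ n, 1 ≤ n → ∃ q : ℕ, q.Prime ∧ q ≤ K * n ∧ fieldSizeBound n s ≤ q := by
  let L := (s + 1) * s + ∑ t ∈ Finset.Icc 1 (s + 1), (s + 1).choose t * (s * (t * (t - 1) / 2))
  refine ⟨2 * (L + 1), fun n hn => ?_⟩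
  obtain ⟨q, hq, hlt, hle⟩ := Nat.exists_prime_lt_and_le_two_mul ((L + 1) * n)
    (Nat.mul_pos L.succ_pos hn).ne'
  refine ⟨q, hq, by rwa [mul_assoc], (fieldSizeBound_le s hn).trans ?_⟩
  exact (Nat.mul_le_mul_right n L.le_succ).trans hlt.le

end FieldSize

theorem mainTheorem5 (s : ℕ) (hs : 2 ≤ s) :
    -- the code and its repair schemes, for all admissible scalars
    (∀ (F : Type*) [Field F] (n k d : ℕ), 1 ≤ k → k + 1 ≤ d → d + 1 ≤ n → d + 1 = k + s →
      ∀ lam : Scalars F n s, Admissible lam →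
        -- repair of the first `s` nodes of a group, with optimal access
        (∀ (h : Fin n) (b : Fin s), nodePos s h = b.castSucc →
          (∀ (c : Fin n → SymbolIndex n s → F) (x : RestIndex (nodeGroup s h)) (p : Fin (n - k)),
            (∑ j, (parityCheck lam (n - k) j).mulVec (c j)) (insertDigit (nodeGroup s h) b x, p) =
              (∑ z, (reducedCheckFirst lam (n - k) h b z).mulVec
                (reducedWord h (downloadFirst F (nodeGroup s h) b) c z)) (x, p)) ∧
          Fintype.card (ReducedNode s h) = n + s - 1 ∧
          Fintype.card (RestIndex (nodeGroup s h)) * s = s ^ (n ⌈/⌉ (s + 1)) ∧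
          IsMDSArrayCode (arrayCode (reducedCheckFirst lam (n - k) h b)) (k + s - 1) ∧
          ∀ 𝓗 : Finset (Fin n), h ∉ 𝓗 → 𝓗.card = d →
            Repairs (secondCode lam (n - k)) h 𝓗 (downloadFirst F (nodeGroup s h) b) ∧
            (repairBandwidth 𝓗 (downloadFirst F (nodeGroup s h) b) : ℚ) =
              cutSetBound k d (s ^ (n ⌈/⌉ (s + 1))) ∧
            (repairAccess 𝓗 (downloadFirst F (nodeGroup s h) b) : ℚ) =
              cutSetBound k d (s ^ (n ⌈/⌉ (s + 1)))) ∧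
        -- repair of the last node of a group, by sums of `s` block rows, without optimal access
        (∀ h : Fin n, nodePos s h = Fin.last s →
          (∀ (c : Fin n → SymbolIndex n s → F) (x : RestIndex (nodeGroup s h)) (p : Fin (n - k)),
            ∑ e : Fin s,
              (∑ j, (parityCheck lam (n - k) j).mulVec (c j)) (insertDigit (nodeGroup s h) e x, p) =
              (∑ z, (reducedCheckLast lam (n - k) h z).mulVec
                (reducedWord h (downloadLast F (nodeGroup s h)) c z)) (x, p)) ∧
          Fintype.card (ReducedNode s h) = n + s - 1 ∧
          Fintype.card (RestIndex (nodeGroup s h)) * s = s ^ (n ⌈/⌉ (s + 1)) ∧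
          IsMDSArrayCode (arrayCode (reducedCheckLast lam (n - k) h)) (k + s - 1) ∧
          ∀ 𝓗 : Finset (Fin n), h ∉ 𝓗 → 𝓗.card = d →
            Repairs (secondCode lam (n - k)) h 𝓗 (downloadLast F (nodeGroup s h)) ∧
            (repairBandwidth 𝓗 (downloadLast F (nodeGroup s h)) : ℚ) =
              cutSetBound k d (s ^ (n ⌈/⌉ (s + 1))) ∧
            (∀ j ∈ 𝓗, nodeGroup s j ≠ nodeGroup s h →
              accessedSymbols (downloadLast F (nodeGroup s h) j) = Set.univ) ∧
            ((∃ j ∈ 𝓗, nodeGroup s j ≠ nodeGroup s h) →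
              cutSetBound k d (s ^ (n ⌈/⌉ (s + 1))) <
                (repairAccess 𝓗 (downloadLast F (nodeGroup s h)) : ℚ))) ∧
        IsMSRCode (secondCode lam (n - k)) k d (s ^ (n ⌈/⌉ (s + 1)))) ∧
    -- admissible scalars exist in every finite field that is large enough
    (∀ (F : Type*) [Field F] [Fintype F] (n : ℕ), 1 ≤ n →
      fieldSizeBound n s ≤ Fintype.card F → ∃ lam : Scalars F n s, Admissible lam) ∧
    -- hence a field size linear in `n` suffices
    (∃ K : ℕ, ∀ n k d : ℕ, 1 ≤ k → k + 1 ≤ d → d + 1 ≤ n → d + 1 = k + s →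
      ∃ q : ℕ, IsPrimePow q ∧ q ≤ K * n ∧
        ∀ (F : Type*) [Field F] [Fintype F], Fintype.card F = q →
          ∃ lam : Scalars F n s, Admissible lam ∧
            IsMSRCode (secondCode lam (n - k)) k d (s ^ (n ⌈/⌉ (s + 1)))) := by
  have hs0 : 0 < s := by omega
  refine ⟨fun F _ n k d _ hkd hdn hd lam hlam => ?_, fun F _ _ n _ hF => exists_admissible hF, ?_⟩
  · have hk : k ≤ n := by omega
    refine ⟨fun h b hb => ⟨parityCheck_sum_eq_reducedCheckFirst lam (n - k) h b hb,
      card_reducedNode h, card_restIndex_mul _,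
      hlam.isMDSArrayCode_reducedCheckFirst hk h b hb, ?_⟩,
      fun h hl => ⟨parityCheck_sum_eq_reducedCheckLast lam (n - k) h hl,
      card_reducedNode h, card_restIndex_mul _,
      hlam.isMDSArrayCode_reducedCheckLast hs0 hk h hl, ?_⟩,
      hlam.isMSRCode_secondCode hs0 hk hd⟩
    · rintro 𝓗 hh rfl
      exact ⟨hlam.repairs_downloadFirst hk hb hh hd, repairBandwidth_eq_cutSetBound hs0 hd _,
        repairAccess_downloadFirst_eq_cutSetBound hs0 hd _ b⟩
    · rintro 𝓗 hh rfl
      exact ⟨hlam.repairs_downloadLast hs0 hk hl hh hd, repairBandwidth_eq_cutSetBound hs0 hd _,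
        fun _ _ => accessedSymbols_downloadLast_of_ne,
        cutSetBound_lt_repairAccess_downloadLast hs hd hl hh⟩
  · obtain ⟨K, hK⟩ := exists_prime_fieldSizeBound_le s
    refine ⟨K, fun n k d _ _ _ hd => ?_⟩
    obtain ⟨q, hq, hqK, hle⟩ := hK n (by omega)
    refine ⟨q, hq.isPrimePow, hqK, fun F _ _ hF => ?_⟩
    obtain ⟨lam, hlam⟩ := exists_admissible (hle.trans_eq hF.symm)
    exact ⟨lam, hlam, hlam.isMSRCode_secondCode hs0 (by omega) hd⟩
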